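/- Let $M,N\ge 0$ and let $\mathfrak s=(s_1,\dots,s_{M+N})$ be an arbitrary $0^M1^N$-sequence (a sequence with exactly $M$ digits $0$ and $N$ digits $1$); write $|i|=s_i$. The super Yangian $Y=Y_{M|N}(\mathfrak s)$ is the unital associative $\mathbb C$-superalgebra generated by $t_{i,j}^{(r)}$ ($1\le i,j\le M+N$, $r\ge1$), of parity $|i|+|j| \bmod 2$, with the relations $$\bigl[t_{i,j}^{(p)},t_{k,l}^{(q)}\bigr]=(-1)^{|i||j|+|i||k|+|j||k|}\sum_{t=0}^{\min(p,q)-1}\bigl(t_{k,j}^{(t)}t_{i,l}^{(p+q-1-t)}-t_{k,j}^{(p+q-1-t)}t_{i,l}^{(t)}\bigr)\qquad(p,q\ge1),$$ where the bracket is the supercommutator and $t_{i,j}^{(0)}=\delta_{i,j}$. Put $t_{i,j}(u)=\sum_{r\ge0}t_{i,j}^{(r)}u^{-r}\in Y[[u^{-1}]]$ and $T(u)=(t_{i,j}(u))_{1\le i,j\le M+N}$. Series in $u+c$, $c\in\mathbb C$, are expanded in powers of $u^{-1}$. Let $T(u)=F(u)D(u)E(u)$ be the unique factorization with $F(u)$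 lower unitriangular, $D(u)=\mathrm{diag}(d_1(u),\dots,d_{M+N}(u))$ diagonal and $E(u)$ upper unitriangular, over $Y[[u^{-1}]]$. Set $\tilde d_i(u)=d_i(u)$ if $s_i=0$ and $\tilde d_i(u)=d_i(u)^{-1}$ if $s_i=1$. Set $u_1=u+s_1$, and let $u_{i+1}$ be $u_i-1$ if $s_i=s_{i+1}=0$, $u_i+1$ if $s_i=s_{i+1}=1$, and $u_i$ if $s_i\ne s_{i+1}$. For $0\le k\le M+N$ let $T_k(u)=(t_{i,j}(u))_{1\le i,j\le k}$, let $T_k(u)^{-1}=(t'_{i,j}(u))_{1\le i,j\le k}$ be its inverse, let $i_1<\dots<i_m$ and $j_1<\dots<j_n$ be the positions of the digits $0$ and $1$, respectively, in $(s_1,\dots,s_k)$, and define the quantum superminor (with products taken from left to right) $$\begin{aligned}\mathrm{qsdet}\,T_k(u)=&\sum_{\rho\in S_m}\mathrm{sgn}(\rho)\,t_{i_{\rho(1)},i_1}(u)\,t_{i_{\rho(2)},i_2}(u-1)\cdots t_{i_{\rho(m)},i_m}(u-m+1)\\ &\times\sum_{\sigma\in S_n}\mathrm{sgn}(\sigma)\,t'_{j_1,j_{\sigma(1)}}(u-m+1)\cdots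 t'_{j_n,j_{\sigma(n)}}(u-m+n),\end{aligned}$$ so that $\mathrm{qsdet}\,T_0(u)=1$. Then for every $1\le i\le M+N$ the superminor $\mathrm{qsdet}\,T_{i-1}(u)$ is invertible in $Y[[u^{-1}]]$ and $$\tilde d_i(u_i)=\bigl(\mathrm{qsdet}\,T_{i-1}(u)\bigr)^{-1}\,\mathrm{qsdet}\,T_i(u).$$ -/

import Mathlib

open scoped BigOperators PowerSeries

noncomputable section

namespace SuperYangian

/-! ### Formal power series in `u⁻¹`

A power series `f : R⟦X⟧` stands for `f(u) = ∑ f^(r) u^{-r}`, so that the variable `X` is `u⁻¹`. -/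

section Series

variable {R : Type*} [Ring R] [Algebra ℂ R] {n : ℕ}

/-- The expansion of `(u + c)⁻¹` in powers of `u⁻¹`, namely `u⁻¹ / (1 + c u⁻¹)`. -/
def shiftedVar (c : ℂ) : ℂ⟦X⟧ :=
  PowerSeries.X * (1 + PowerSeries.C c * PowerSeries.X)⁻¹

/-- `shift c f` is the series `f(u + c) = ∑ f^(r) (u + c)^{-r}`, expanded in powers of `u⁻¹`
(the terms with `r > m` do not contribute to the coefficient of `u^{-m}`). -/
def shift (c : ℂ) (f : R⟦X⟧) : R⟦X⟧ :=
  PowerSeries.mk fun m =>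
    ∑ r ∈ Finset.range (m + 1),
      PowerSeries.coeff m (shiftedVar c ^ r) • PowerSeries.coeff r f

end Series

/-! ### Gauss decomposition of a matrix of series congruent to the identity modulo `u⁻¹` -/

section Gauss

variable {R : Type*} [Ring R] {n : ℕ}

/-- `A` is congruent to the identity matrix modulo `u⁻¹`. -/
def IsOneModX (A : Matrix (Fin n) (Fin n) R⟦X⟧) : Prop :=
  ∀ i j, PowerSeries.constantCoeff (A i j) = if i = j then 1 else 0

/-- `A = F D E` with `F` lower unitriangular, `D` the diagonal matrix with entries `d`, and
`E` upper unitriangular. -/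
structure IsGaussDecomposition (A F : Matrix (Fin n) (Fin n) R⟦X⟧) (d : Fin n → R⟦X⟧)
    (E : Matrix (Fin n) (Fin n) R⟦X⟧) : Prop where
  lower_diag : ∀ i, F i i = 1
  lower_zero : ∀ i j, i < j → F i j = 0
  upper_diag : ∀ i, E i i = 1
  upper_zero : ∀ i j, j < i → E i j = 0
  eq_mul : A = F * Matrix.diagonal d * E

theorem isUnit_of_constantCoeff_one {f : R⟦X⟧} (h : PowerSeries.constantCoeff f = 1) :
    IsUnit f :=
  ⟨⟨f, PowerSeries.invOfUnit f 1, PowerSeries.mul_invOfUnit f 1 (by simpa using h),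
    PowerSeries.invOfUnit_mul f 1 (by simpa using h)⟩, rfl⟩

/-- A matrix of series that is congruent to the identity modulo `u⁻¹` is invertible. -/
theorem isUnit_of_isOneModX {A : Matrix (Fin n) (Fin n) R⟦X⟧} (hA : IsOneModX A) :
    IsUnit A := by
  let toS : Matrix (Fin n) (Fin n) R⟦X⟧ → (Matrix (Fin n) (Fin n) R)⟦X⟧ := fun B =>
    PowerSeries.mk fun m => Matrix.of fun i j => PowerSeries.coeff m (B i j)
  have inj : Function.Injective toS := by
    intro B C h
    ext i j m
    have := congrArg (PowerSeries.coeff m) h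
    simp only [toS, PowerSeries.coeff_mk] at this
    exact Matrix.ext_iff.2 this i j
  have surj : Function.Surjective toS := by
    intro S
    refine ⟨Matrix.of fun i j => PowerSeries.mk fun m => PowerSeries.coeff m S i j, ?_⟩
    ext m i j
    simp [toS]
  have hmul : ∀ B C, toS (B * C) = toS B * toS C := by
    intro B C
    ext m i j
    simp only [toS, PowerSeries.coeff_mk, PowerSeries.coeff_mul, Matrix.of_apply,
      Matrix.mul_apply, Matrix.sum_apply, map_sum]
    rw [Finset.sum_comm]
  have hone : toS 1 = 1 := by
    ext m i j
    by_cases hm : m = 0 <;> by_cases hij : i = j <;>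
      simp [toS, PowerSeries.coeff_one, Matrix.one_apply, hm, hij]
  have hc : PowerSeries.constantCoeff (toS A) = 1 := by
    ext i j
    have := hA i j
    simp only [← PowerSeries.coeff_zero_eq_constantCoeff_apply] at this ⊢
    simpa [toS, Matrix.one_apply] using this
  obtain ⟨B, hB⟩ := surj (PowerSeries.invOfUnit (toS A) 1)
  refine ⟨⟨A, B, inj ?_, inj ?_⟩, rfl⟩
  · rw [hmul, hB, hone]
    exact PowerSeries.mul_invOfUnit _ 1 (by simpa using hc)
  · rw [hmul, hB, hone]
    exact PowerSeries.invOfUnit_mul _ 1 (by simpa using hc)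

/-- The matrix left after `k` steps of Gaussian elimination. -/
def elim (A : Matrix (Fin n) (Fin n) R⟦X⟧) : ℕ → Matrix (Fin n) (Fin n) R⟦X⟧
  | 0 => A
  | k + 1 => Matrix.of fun i j =>
      if h : k < n then
        elim A k i j - elim A k i ⟨k, h⟩ * Ring.inverse (elim A k ⟨k, h⟩ ⟨k, h⟩) *
          elim A k ⟨k, h⟩ j
      else elim A k i j

theorem constantCoeff_elim {A : Matrix (Fin n) (Fin n) R⟦X⟧} (hA : IsOneModX A) (k : ℕ) :
    ∀ i j : Fin n, k ≤ i → k ≤ j →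
      PowerSeries.constantCoeff (elim A k i j) = if i = j then 1 else 0 := by
  induction k with
  | zero => intro i j _ _; exact hA i j
  | succ k ih =>
    intro i j hi hj
    have hk : k < n := by omega
    have h1 := ih i ⟨k, hk⟩ (by omega) le_rfl
    rw [if_neg (by intro h; rw [h] at hi; simp at hi)] at h1
    simp only [elim, Matrix.of_apply, hk, dite_true, map_sub, map_mul, h1, zero_mul, sub_zero]
    exact ih i j (by omega) (by omega)

theorem isUnit_pivot {A : Matrix (Fin n) (Fin n) R⟦X⟧} (hA : IsOneModX A) (k : Fin n) :
    IsUnit (elim A k k k) :=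
  isUnit_of_constantCoeff_one (by rw [constantCoeff_elim hA k k k le_rfl le_rfl, if_pos rfl])

theorem elim_eq_zero {A : Matrix (Fin n) (Fin n) R⟦X⟧} (hA : IsOneModX A) (k : ℕ) :
    ∀ i j : Fin n, (i : ℕ) < k ∨ (j : ℕ) < k → elim A k i j = 0 := by
  induction k with
  | zero => intro i j h; omega
  | succ k ih =>
    intro i j h
    by_cases hk : k < n
    · have hu : IsUnit (elim A k ⟨k, hk⟩ ⟨k, hk⟩) := isUnit_pivot hA ⟨k, hk⟩
      simp only [elim, Matrix.of_apply, hk, dite_true]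
      by_cases hi : (i : ℕ) < k
      · rw [ih i j (Or.inl hi), ih i ⟨k, hk⟩ (Or.inl hi)]; simp
      · by_cases hj : (j : ℕ) < k
        · rw [ih i j (Or.inr hj), ih ⟨k, hk⟩ j (Or.inr hj)]; simp
        · rcases h with h | h
          · have : i = ⟨k, hk⟩ := Fin.ext (by simp; omega)
            rw [this, Ring.mul_inverse_cancel _ hu]; simp
          · have : j = ⟨k, hk⟩ := Fin.ext (by simp; omega)
            rw [this, mul_assoc, Ring.inverse_mul_cancel _ hu]; simp
    · simp only [elim, Matrix.of_apply, hk, dite_false]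
      exact ih i j (by omega)

/-- A matrix of series that is congruent to the identity modulo `u⁻¹` has a Gauss decomposition,
whose diagonal entries are invertible. -/
theorem exists_isGaussDecomposition {A : Matrix (Fin n) (Fin n) R⟦X⟧} (hA : IsOneModX A) :
    ∃ (F : Matrix (Fin n) (Fin n) R⟦X⟧) (d : Fin n → R⟦X⟧) (E : Matrix (Fin n) (Fin n) R⟦X⟧),
      IsGaussDecomposition A F d E ∧ ∀ k, IsUnit (d k) := by
  have hu := isUnit_pivot hA
  refine ⟨Matrix.of fun i k => elim A k i k * Ring.inverse (elim A k k k),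
    fun k => elim A k k k, Matrix.of fun k j => Ring.inverse (elim A k k k) * elim A k k j, ⟨?_, ?_, ?_, ?_, ?_⟩, hu⟩
  · exact fun i => Ring.mul_inverse_cancel _ (hu i)
  · intro i j hij
    rw [Matrix.of_apply, elim_eq_zero hA j i j (Or.inl hij), zero_mul]
  · exact fun i => Ring.inverse_mul_cancel _ (hu i)
  · intro i j hij
    rw [Matrix.of_apply, elim_eq_zero hA i i j (Or.inr hij), mul_zero]
  · have key : ∀ m, m ≤ n → ∀ i j : Fin n, A i j - elim A m i j =
        ∑ k ∈ Finset.range m, if h : k < n then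
          elim A k i ⟨k, h⟩ * Ring.inverse (elim A k ⟨k, h⟩ ⟨k, h⟩) * elim A k ⟨k, h⟩ j
        else 0 := by
      intro m
      induction m with
      | zero => intro _ i j; simp [elim]
      | succ m ih =>
        intro hm i j
        have hm' : m < n := hm
        rw [Finset.sum_range_succ, ← ih (by omega) i j]
        simp only [elim, Matrix.of_apply, hm', dite_true]
        abel
    ext1 i j
    have h := key n le_rfl i j
    rw [elim_eq_zero hA n i j (Or.inl i.2), sub_zero] at h
    rw [h, Finset.sum_range]
    rw [Matrix.mul_apply]
    refine Finset.sum_congr rfl fun k _ => ?_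
    rw [Matrix.mul_diagonal, Matrix.of_apply, Matrix.of_apply]
    simp only [k.2, dite_true, Fin.eta]
    rw [mul_assoc _ (Ring.inverse _) (elim A k k k), Ring.inverse_mul_cancel _ (hu k), mul_one,
      mul_assoc]

theorem IsGaussDecomposition.unique {A F F' E E' : Matrix (Fin n) (Fin n) R⟦X⟧}
    {d d' : Fin n → R⟦X⟧} (hG : IsGaussDecomposition A F d E)
    (hG' : IsGaussDecomposition A F' d' E') (hd : ∀ k, IsUnit (d k)) :
    F = F' ∧ d = d' ∧ E = E' := by
  have hsum : ∀ i j, ∑ k, (F i k * d k * E k j - F' i k * d' k * E' k j) = 0 := by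
    intro i j
    have h1 := congrFun (congrFun hG.eq_mul i) j
    have h2 := congrFun (congrFun hG'.eq_mul i) j
    rw [Matrix.mul_apply] at h1 h2
    simp only [Matrix.mul_diagonal] at h1 h2
    rw [Finset.sum_sub_distrib, ← h1, ← h2, sub_self]
  have main : ∀ m : ℕ, ∀ k : Fin n, (k : ℕ) = m →
      (∀ j, F j k = F' j k) ∧ d k = d' k ∧ ∀ j, E k j = E' k j := by
    intro m
    induction m using Nat.strong_induction_on with
    | _ m ih =>
      rintro k rfl
      have row : ∀ j, d k * E k j = d' k * E' k j := by
        intro j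
        have h := hsum k j
        rw [Finset.sum_eq_single k] at h
        · simpa [hG.lower_diag, hG'.lower_diag, sub_eq_zero] using h
        · intro l _ hl
          rcases lt_or_gt_of_ne hl with hlt | hgt
          · obtain ⟨a, b, c⟩ := ih l hlt l rfl
            rw [a, b, c, sub_self]
          · rw [hG.lower_zero k l hgt, hG'.lower_zero k l hgt]; simp
        · simp
      have col : ∀ j, F j k * d k = F' j k * d' k := by
        intro j
        have h := hsum j k
        rw [Finset.sum_eq_single k] at h
        · simpa [hG.upper_diag, hG'.upper_diag, sub_eq_zero] using h
        · intro l _ hl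
          rcases lt_or_gt_of_ne hl with hlt | hgt
          · obtain ⟨a, b, c⟩ := ih l hlt l rfl
            rw [a, b, c, sub_self]
          · rw [hG.upper_zero l k hgt, hG'.upper_zero l k hgt]; simp
        · simp
      have hdk : d k = d' k := by
        simpa [hG.upper_diag, hG'.upper_diag] using row k
      refine ⟨fun j => ?_, hdk, fun j => ?_⟩
      · have h := col j
        rw [← hdk] at h
        exact (hd k).mul_right_cancel h
      · have h := row j
        rw [← hdk] at h
        exact (hd k).mul_left_cancel h
  refine ⟨?_, ?_, ?_⟩
  · ext1 i j; exact (main j j rfl).1 i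
  · funext k; exact (main k k rfl).2.1
  · ext1 i j; exact (main i i rfl).2.2 j

end Gauss

/-! ### The super Yangian -/

section Yangian

variable {n : ℕ}

/-- `s` is a `0^M 1^N`-sequence: it has exactly `M` digits `0` and `N` digits `1`. -/
def IsZeroOneSeq (M N : ℕ) (s : Fin (M + N) → Fin 2) : Prop :=
  (Finset.univ.filter fun i => s i = 0).card = M ∧ (Finset.univ.filter fun i => s i = 1).card = N

/-- The free algebra on the symbols `t_{i,j}^{(r)}`, `r ≥ 1`; the symbol indexed by `(i, j, r)`
is `t_{i,j}^{(r+1)}`. -/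
abbrev Free (n : ℕ) : Type := FreeAlgebra ℂ (Fin n × Fin n × ℕ)

/-- `t_{i,j}^{(r)}` in the free algebra, with the convention `t_{i,j}^{(0)} = δ_{i,j}`. -/
def freeT (i j : Fin n) : ℕ → Free n
  | 0 => if i = j then 1 else 0
  | r + 1 => FreeAlgebra.ι ℂ (i, j, r)

/-- The parity `|i| + |j|` of `t_{i,j}^{(r)}`, as a natural number (only its class modulo `2`
matters). -/
def parity (s : Fin n → Fin 2) (i j : Fin n) : ℕ := (s i : ℕ) + (s j : ℕ)

/-- The defining relations of the super Yangian: the left-hand side is the supercommutator of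
`t_{i,j}^{(p)}` and `t_{k,l}^{(q)}`. -/
inductive Rel (s : Fin n → Fin 2) : Free n → Free n → Prop
  | rtt (i j k l : Fin n) (p q : ℕ) (hp : 1 ≤ p) (hq : 1 ≤ q) :
      Rel s
        (freeT i j p * freeT k l q -
          (-1) ^ (parity s i j * parity s k l) * (freeT k l q * freeT i j p))
        ((-1) ^ ((s i : ℕ) * (s j : ℕ) + (s i : ℕ) * (s k : ℕ) + (s j : ℕ) * (s k : ℕ)) *
          ∑ t ∈ Finset.range (min p q),
            (freeT k j t * freeT i l (p + q - 1 - t) - freeT k j (p + q - 1 - t) * freeT i l t))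

/-- The super Yangian `Y_{M|N}(s)`. -/
abbrev Yangian (s : Fin n → Fin 2) : Type := RingQuot (Rel s)

/-- The element `t_{i,j}^{(r)}` of the super Yangian. -/
def t (s : Fin n → Fin 2) (i j : Fin n) (r : ℕ) : Yangian s :=
  RingQuot.mkAlgHom ℂ (Rel s) (freeT i j r)

/-- The matrix `T(u) = (t_{i,j}(u))`, `t_{i,j}(u) = ∑_{r ≥ 0} t_{i,j}^{(r)} u^{-r}`. -/
def T (s : Fin n → Fin 2) : Matrix (Fin n) (Fin n) (Yangian s)⟦X⟧ :=
  Matrix.of fun i j => PowerSeries.mk fun r => t s i j r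

theorem isOneModX_T (s : Fin n → Fin 2) : IsOneModX (T s) := by
  intro i j
  rw [← PowerSeries.coeff_zero_eq_constantCoeff_apply]
  by_cases h : i = j <;> simp [T, t, freeT, h]

/-- The Drinfeld generator series `d_i(u)`: the `i`-th diagonal entry of the matrix `D(u)` in the
(unique) Gauss decomposition `T(u) = F(u) D(u) E(u)`. -/
def d (s : Fin n → Fin 2) : Fin n → (Yangian s)⟦X⟧ :=
  (exists_isGaussDecomposition (isOneModX_T s)).choose_spec.choose

theorem d_spec (s : Fin n → Fin 2) :
    ∃ F E, IsGaussDecomposition (T s) F (d s) E ∧ ∀ k, IsUnit (d s k) :=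
  ⟨_, (exists_isGaussDecomposition (isOneModX_T s)).choose_spec.choose_spec⟩

theorem d_eq_of_isGaussDecomposition (s : Fin n → Fin 2)
    {F E : Matrix (Fin n) (Fin n) (Yangian s)⟦X⟧} {d' : Fin n → (Yangian s)⟦X⟧}
    (h : IsGaussDecomposition (T s) F d' E) : d' = d s := by
  obtain ⟨F₀, E₀, h₀, hu⟩ := d_spec s
  exact (h₀.unique h hu).2.1.symm

/-- `d̃_i(u)` is `d_i(u)` if `s_i = 0` and `d_i(u)⁻¹` if `s_i = 1`. -/
def dTilde (s : Fin n → Fin 2) (i : Fin n) : (Yangian s)⟦X⟧ :=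
  if s i = 0 then d s i else Ring.inverse (d s i)

/-- The integer `c_i` with `u_i = u + c_i`, for zero-based `i`. -/
def uOffset (s : Fin n → Fin 2) : (i : ℕ) → i < n → ℤ
  | 0, h => ((s ⟨0, h⟩ : ℕ) : ℤ)
  | i + 1, h =>
      if s ⟨i, Nat.lt_of_succ_lt h⟩ = s ⟨i + 1, h⟩ then
        if s ⟨i, Nat.lt_of_succ_lt h⟩ = 0 then uOffset s i (Nat.lt_of_succ_lt h) - 1
        else uOffset s i (Nat.lt_of_succ_lt h) + 1
      else uOffset s i (Nat.lt_of_succ_lt h)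

end Yangian

/-! ### Quantum Berezinians and quantum superminors -/

section Berezinian

variable {R : Type*} [Ring R] [Algebra ℂ R] {n : ℕ}

/-- The positions of the digit `0` (for `a = 0`) or `1` (for `a = 1`) in `s`. -/
def positions (s : Fin n → Fin 2) (a : Fin 2) : Finset (Fin n) :=
  Finset.univ.filter fun i => s i = a

/-- The increasing enumeration of the positions of the digit `a`: `i_1 < i_2 < ⋯` for `a = 0` and
`j_1 < j_2 < ⋯` for `a = 1`. -/
def pos (s : Fin n → Fin 2) (a : Fin 2) : Fin (positions s a).card ↪o Fin n :=
  (positions s a).orderEmbOfFin rfl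

/-- The quantum Berezinian of a square matrix `A(u)` of series whose rows and columns have the
parities prescribed by `s`. With `M` zeros and `N` ones in `s`, it is
`∑_ρ sgn ρ a_{i_{ρ(1)},i_1}(u) ⋯ a_{i_{ρ(M)},i_M}(u-M+1)` times
`∑_σ sgn σ a'_{j_1,j_{σ(1)}}(u-M+1) ⋯ a'_{j_N,j_{σ(N)}}(u-M+N)`, where `(a'_{i,j}(u))` is the
two-sided inverse of the matrix `A(u)`. The (noncommutative) products are taken from left to
right, and the positions `k`, `l` below are zero-based. -/
def qsdet (s : Fin n → Fin 2) (A : Matrix (Fin n) (Fin n) R⟦X⟧) : R⟦X⟧ :=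
  (∑ ρ : Equiv.Perm (Fin (positions s 0).card),
      (Equiv.Perm.sign ρ : ℤ) •
        (List.ofFn fun k => shift (-(k : ℂ)) (A (pos s 0 (ρ k)) (pos s 0 k))).prod) *
  ∑ σ : Equiv.Perm (Fin (positions s 1).card),
      (Equiv.Perm.sign σ : ℤ) •
        (List.ofFn fun l => shift (-((positions s 0).card : ℂ) + 1 + (l : ℂ))
          (Ring.inverse A (pos s 1 l) (pos s 1 (σ l)))).prod

end Berezinian

section Superminor

variable {n : ℕ}

/-- The first `k` digits of `s`. -/
def leadingSeq (s : Fin n → Fin 2) (k : ℕ) (hk : k ≤ n) : Fin k → Fin 2 :=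
  fun i => s (Fin.castLE hk i)

/-- The leading `k × k` submatrix of `T(u)`. -/
def leadingT (s : Fin n → Fin 2) (k : ℕ) (hk : k ≤ n) :
    Matrix (Fin k) (Fin k) (Yangian s)⟦X⟧ :=
  (T s).submatrix (Fin.castLE hk) (Fin.castLE hk)

theorem isUnit_leadingT (s : Fin n → Fin 2) (k : ℕ) (hk : k ≤ n) : IsUnit (leadingT s k hk) :=
  isUnit_of_isOneModX fun i j => by
    simpa [leadingT, Fin.ext_iff] using isOneModX_T s (Fin.castLE hk i) (Fin.castLE hk j)

/-- The quantum superminor of the leading `k × k` submatrix of `T(u)`; it equals `1` for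
`k = 0`. -/
def superminor (s : Fin n → Fin 2) (k : ℕ) (hk : k ≤ n) : (Yangian s)⟦X⟧ :=
  qsdet (leadingSeq s k hk) (leadingT s k hk)

end Superminor

end SuperYangian

end

/-! For an index set $S$ let $G_S(u)$ be the inverse of the block of $T(u)$ on $S$. Its diagonal
entries are inverse quasideterminants; for a leading block the last one is the inverse of $d_k(u)$
(`IsGaussDecomposition.inv_mul`). The defining relation passes to $G_S$ with reversed sign
(`IsRTT.inv`).

At arguments one unit apart, the relations make both alternating sums in the superminor
antisymmetric in their labels, so Cramer's rule holds for them (`rowDet_succ`, `colDet_succ`). Let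
$U$ be the even indices in the leading block $K$, and $j_1<\dots<j_n$ the odd ones. The odd factor
unfolds into the ordered product of the entries of $G_{U\cup\{j_1,\dots,j_p\}}(v+p-1)$ at
$(j_p,j_p)$ (`colDet_eq_prod`). Appending an odd digit therefore appends one factor on the right
(`odd_step`).

Appending an even digit $k$, after $m$ earlier zeros, multiplies the even factor by the inverse of
$G_U(u-m)_{kk}$, which then has to cross the odd factor. Each crossing is the identity
$G_{S\setminus j}(w)_{kk}\,G_{S\setminus k}(w+1)_{jj}=G_S(w)_{jj}\,G_S(w+1)_{kk}$ (`exchange`): the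
block of the moving factor gains $j$, the block of the odd factor loses $k$, and both arguments rise
by one. After $n$ crossings the inverse of $G_K(u-m+n)_{kk}$ remains, which is $d_k(u-m+n)$
(`even_step`).

In both cases the offset is (number of earlier ones) − (number of earlier zeros) + $s_i$, which is
the closed form of $u_i-u$. -/

noncomputable section

namespace SuperYangian

/-! ### Shifts of series in $u^{-1}$ and two-parameter expansions. -/

section ShiftHom

variable {R : Type*} [Ring R] [Algebra ℂ R]

theorem X_dvd_shiftedVar (c : ℂ) : (PowerSeries.X : ℂ⟦X⟧) ∣ shiftedVar c :=
  Dvd.intro _ rfl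

theorem coeff_shiftedVar_pow_eq_zero (p q : ℂ) {m r k : ℕ} (h : m < r + k) :
    PowerSeries.coeff m (shiftedVar p ^ r * shiftedVar q ^ k) = 0 := by
  have : (PowerSeries.X : ℂ⟦X⟧) ^ (r + k) ∣ shiftedVar p ^ r * shiftedVar q ^ k := by
    rw [pow_add]
    exact mul_dvd_mul (pow_dvd_pow_of_dvd (X_dvd_shiftedVar p) r)
      (pow_dvd_pow_of_dvd (X_dvd_shiftedVar q) k)
  exact PowerSeries.X_pow_dvd_iff.1 this m h

/-- Partial fractions for $1/((u+p)(u+q))$. This is how the scalar $p-q$ is traded for a difference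
of degree shifts. -/
theorem sub_shiftedVar (p q : ℂ) :
    (p - q) • (shiftedVar p * shiftedVar q) = shiftedVar q - shiftedVar p := by
  have hp : ∀ c : ℂ, (1 + PowerSeries.C c * PowerSeries.X : ℂ⟦X⟧) *
      (1 + PowerSeries.C c * PowerSeries.X)⁻¹ = 1 := fun c =>
    PowerSeries.mul_inv_cancel _ (by simp)
  have h1 := hp p
  have h2 := hp q
  simp only [shiftedVar, PowerSeries.smul_eq_C_mul, map_sub]
  set a := (1 + PowerSeries.C p * PowerSeries.X : ℂ⟦X⟧)⁻¹
  set b := (1 + PowerSeries.C q * PowerSeries.X : ℂ⟦X⟧)⁻¹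
  linear_combination PowerSeries.X * b * h1 - PowerSeries.X * a * h2

/-- The double series `∑ h(r, k) (u + p)^{-r} (u + q)^{-k}`, expanded in powers of `u⁻¹`. -/
def doubleSeries (p q : ℂ) (h : ℕ → ℕ → R) : R⟦X⟧ :=
  PowerSeries.mk fun m => ∑ r ∈ Finset.range (m + 1), ∑ k ∈ Finset.range (m + 1),
    PowerSeries.coeff m (shiftedVar p ^ r * shiftedVar q ^ k) • h r k

theorem coeff_doubleSeries (p q : ℂ) (h : ℕ → ℕ → R) {m n : ℕ} (hn : m < n) :
    PowerSeries.coeff m (doubleSeries p q h) = ∑ r ∈ Finset.range n, ∑ k ∈ Finset.range n,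
      PowerSeries.coeff m (shiftedVar p ^ r * shiftedVar q ^ k) • h r k := by
  rw [doubleSeries, PowerSeries.coeff_mk]
  have hsub : Finset.range (m + 1) ⊆ Finset.range n := Finset.range_mono hn
  rw [Finset.sum_subset hsub]
  · refine Finset.sum_congr rfl fun r _ => Finset.sum_subset hsub fun k _ hk => ?_
    rw [Finset.mem_range] at hk
    rw [coeff_shiftedVar_pow_eq_zero p q (by omega), zero_smul]
  · intro r _ hr
    rw [Finset.mem_range] at hr
    refine Finset.sum_eq_zero fun k _ => ?_
    rw [coeff_shiftedVar_pow_eq_zero p q (by omega), zero_smul]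

theorem coeff_shift (c : ℂ) (f : R⟦X⟧) {m n : ℕ} (hn : m < n) :
    PowerSeries.coeff m (shift c f) = ∑ r ∈ Finset.range n,
      PowerSeries.coeff m (shiftedVar c ^ r) • PowerSeries.coeff r f := by
  rw [shift, PowerSeries.coeff_mk]
  refine Finset.sum_subset (Finset.range_mono hn) fun r _ hr => ?_
  rw [Finset.mem_range] at hr
  have := coeff_shiftedVar_pow_eq_zero c c (m := m) (r := r) (k := 0) (by omega)
  rw [pow_zero, mul_one] at this
  rw [this, zero_smul]

theorem shift_mul_shift (p q : ℂ) (f g : R⟦X⟧) :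
    shift p f * shift q g =
      doubleSeries p q fun r k => PowerSeries.coeff r f * PowerSeries.coeff k g := by
  ext m
  rw [PowerSeries.coeff_mul, coeff_doubleSeries p q _ (Nat.lt_succ_self m)]
  have : ∀ a ∈ Finset.HasAntidiagonal.antidiagonal m, PowerSeries.coeff a.1 (shift p f) *
      PowerSeries.coeff a.2 (shift q g) = ∑ r ∈ Finset.range (m + 1), ∑ k ∈ Finset.range (m + 1),
        (PowerSeries.coeff a.1 (shiftedVar p ^ r) * PowerSeries.coeff a.2 (shiftedVar q ^ k)) •
          (PowerSeries.coeff r f * PowerSeries.coeff k g) := by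
    intro a ha
    rw [Finset.HasAntidiagonal.mem_antidiagonal] at ha
    rw [coeff_shift p f (n := m + 1) (by omega), coeff_shift q g (n := m + 1) (by omega),
      Finset.sum_mul_sum]
    simp only [smul_mul_smul_comm]
  rw [Finset.sum_congr rfl this, Finset.sum_comm]
  refine Finset.sum_congr rfl fun r _ => ?_
  rw [Finset.sum_comm]
  refine Finset.sum_congr rfl fun k _ => ?_
  rw [← Finset.sum_smul, PowerSeries.coeff_mul]

theorem doubleSeries_swap (p q : ℂ) (h : ℕ → ℕ → R) :
    doubleSeries q p (fun k r => h r k) = doubleSeries p q h := by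
  ext m
  rw [doubleSeries, doubleSeries, PowerSeries.coeff_mk, PowerSeries.coeff_mk, Finset.sum_comm]
  simp only [mul_comm]

theorem doubleSeries_sub (p q : ℂ) (h h' : ℕ → ℕ → R) :
    doubleSeries p q (fun r k => h r k - h' r k) = doubleSeries p q h - doubleSeries p q h' := by
  ext m
  simp [doubleSeries, smul_sub, Finset.sum_sub_distrib]

theorem doubleSeries_smul (p q c : ℂ) (h : ℕ → ℕ → R) :
    doubleSeries p q (fun r k => c • h r k) = c • doubleSeries p q h := by
  ext m
  simp [doubleSeries, smul_comm _ c, Finset.smul_sum]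

/-- The unary shift `h(r, k) ↦ h(r - 1, k)`. -/
def delayFst (h : ℕ → ℕ → R) : ℕ → ℕ → R
  | 0, _ => 0
  | r + 1, k => h r k

/-- The unary shift `h(r, k) ↦ h(r, k - 1)`. -/
def delaySnd (h : ℕ → ℕ → R) : ℕ → ℕ → R
  | _, 0 => 0
  | r, k + 1 => h r k

theorem map_shiftedVar_mul_doubleSeries_fst (p q : ℂ) (h : ℕ → ℕ → R) :
    PowerSeries.map (algebraMap ℂ R) (shiftedVar p) * doubleSeries p q h =
      doubleSeries p q (delayFst h) := by
  ext m
  rw [PowerSeries.coeff_mul, doubleSeries.eq_def p q (delayFst h), PowerSeries.coeff_mk,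
    Finset.sum_range_succ']
  simp only [delayFst, smul_zero, Finset.sum_const_zero, add_zero]
  have : ∀ a ∈ Finset.HasAntidiagonal.antidiagonal m,
      PowerSeries.coeff a.1 (PowerSeries.map (algebraMap ℂ R) (shiftedVar p)) *
      PowerSeries.coeff a.2 (doubleSeries p q h) =
        ∑ r ∈ Finset.range (m + 1), ∑ k ∈ Finset.range (m + 1),
        (PowerSeries.coeff a.1 (shiftedVar p) *
          PowerSeries.coeff a.2 (shiftedVar p ^ r * shiftedVar q ^ k)) • h r k := by
    intro a ha
    rw [Finset.HasAntidiagonal.mem_antidiagonal] at ha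
    rw [coeff_doubleSeries p q h (n := m + 1) (by omega), PowerSeries.coeff_map,
      ← Algebra.smul_def, Finset.smul_sum]
    simp only [Finset.smul_sum, smul_smul]
  rw [Finset.sum_congr rfl this, Finset.sum_comm, Finset.sum_range_succ]
  have key : ∀ r, ∑ a ∈ Finset.HasAntidiagonal.antidiagonal m, ∑ k ∈ Finset.range (m + 1),
      (PowerSeries.coeff a.1 (shiftedVar p) *
          PowerSeries.coeff a.2 (shiftedVar p ^ r * shiftedVar q ^ k)) • h r k =
      ∑ k ∈ Finset.range (m + 1),
        PowerSeries.coeff m (shiftedVar p ^ (r + 1) * shiftedVar q ^ k) • h r k := by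
    intro r
    rw [Finset.sum_comm]
    refine Finset.sum_congr rfl fun k _ => ?_
    rw [← Finset.sum_smul, ← PowerSeries.coeff_mul, ← mul_assoc, pow_succ']
  rw [Finset.sum_congr rfl fun r _ => key r, key m]
  rw [add_eq_left]
  refine Finset.sum_eq_zero fun k _ => ?_
  rw [coeff_shiftedVar_pow_eq_zero p q (by omega), zero_smul]

theorem map_shiftedVar_mul_doubleSeries_snd (p q : ℂ) (h : ℕ → ℕ → R) :
    PowerSeries.map (algebraMap ℂ R) (shiftedVar q) * doubleSeries p q h =
      doubleSeries p q (delaySnd h) := by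
  rw [← doubleSeries_swap, map_shiftedVar_mul_doubleSeries_fst, ← doubleSeries_swap]
  congr 1
  funext r k
  cases k <;> rfl

/-- $(u+c)^{-1}$ is $u^{-1}$ times a unit with scalar coefficients, so it cancels whatever the zero
divisors of `R`. -/
theorem map_shiftedVar_mul_cancel (c : ℂ) {f g : R⟦X⟧}
    (h : PowerSeries.map (algebraMap ℂ R) (shiftedVar c) * f =
      PowerSeries.map (algebraMap ℂ R) (shiftedVar c) * g) : f = g := by
  have h2 : (1 + PowerSeries.C c * PowerSeries.X : ℂ⟦X⟧) * shiftedVar c = PowerSeries.X := by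
    have := PowerSeries.mul_inv_cancel (1 + PowerSeries.C c * PowerSeries.X : ℂ⟦X⟧) (by simp)
    rw [shiftedVar, mul_left_comm, this, mul_one]
  have h3 := congrArg (fun x => PowerSeries.map (algebraMap ℂ R)
    (1 + PowerSeries.C c * PowerSeries.X) * x) h
  simp only [← mul_assoc, ← map_mul, h2, PowerSeries.map_X] at h3
  ext m
  have := congrArg (PowerSeries.coeff (m + 1)) h3
  rwa [PowerSeries.coeff_succ_X_mul, PowerSeries.coeff_succ_X_mul] at this

/-- Turns a recursion between coefficients into an identity of series: after multiplication by
$(u+p)^{-1}(u+q)^{-1}$ the factor $p-q$ becomes the difference of the two delays. The vanishing on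
the edges covers the indices that the recursion does not reach. -/
theorem smul_doubleSeries_eq (p q : ℂ) {h g : ℕ → ℕ → R} (h₁ : ∀ k, h 0 k = 0)
    (h₂ : ∀ r, h r 0 = 0) (hg : ∀ r k, h (r + 1) k - h r (k + 1) = g r k) :
    (p - q) • doubleSeries p q h = doubleSeries p q g := by
  apply map_shiftedVar_mul_cancel p
  apply map_shiftedVar_mul_cancel q
  have e1 : PowerSeries.map (algebraMap ℂ R) (shiftedVar q) *
      (PowerSeries.map (algebraMap ℂ R) (shiftedVar p) * ((p - q) • doubleSeries p q h)) =
      PowerSeries.map (algebraMap ℂ R) (shiftedVar q - shiftedVar p) * doubleSeries p q h := by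
    have e2 : ∀ (c : ℂ) (f : ℂ⟦X⟧), PowerSeries.map (algebraMap ℂ R) (c • f) =
        c • PowerSeries.map (algebraMap ℂ R) f := by
      intro c f
      ext m
      rw [PowerSeries.coeff_map, PowerSeries.coeff_smul, PowerSeries.coeff_smul,
        PowerSeries.coeff_map, smul_eq_mul, map_mul, Algebra.smul_def]
    rw [← sub_shiftedVar, e2, ← mul_assoc, ← map_mul, mul_comm (shiftedVar q), mul_smul_comm,
      smul_mul_assoc]
  rw [e1, map_sub, sub_mul, map_shiftedVar_mul_doubleSeries_fst,
    map_shiftedVar_mul_doubleSeries_snd, map_shiftedVar_mul_doubleSeries_fst,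
    map_shiftedVar_mul_doubleSeries_snd, ← doubleSeries_sub]
  congr 1
  funext r k
  cases r with
  | zero => cases k <;> simp [delayFst, delaySnd, h₁]
  | succ r =>
    cases k with
    | zero => simp [delayFst, delaySnd, h₂]
    | succ k => simp [delayFst, delaySnd, hg]

/-- The shift `f(u) ↦ f(u + c)` as a ring homomorphism. -/
def shiftHom (c : ℂ) : R⟦X⟧ →+* R⟦X⟧ where
  toFun := shift c
  map_one' := by
    ext m
    rw [coeff_shift c _ (Nat.lt_succ_self m), Finset.sum_eq_single 0]
    · by_cases h : m = 0 <;> simp [PowerSeries.coeff_one, h]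
    · intro r _ hr
      simp [PowerSeries.coeff_one, hr]
    · simp
  map_mul' f g := by
    have hc : ∀ m, PowerSeries.coeff m (shift c (f * g)) =
        PowerSeries.coeff m (shift c f * shift c g) := by
      intro m
      rw [shift_mul_shift, coeff_doubleSeries c c _ (n := 2 * m + 2) (by omega),
        coeff_shift c _ (Nat.lt_succ_self m)]
      simp only [PowerSeries.coeff_mul, Finset.smul_sum]
      rw [← Finset.sum_product', Finset.sum_sigma']
      refine Finset.sum_of_injOn (fun x => (x.2.1, x.2.2)) ?_ ?_ ?_ ?_
      · rintro ⟨a, b, c⟩ h ⟨a', b', c'⟩ h' e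
        simp at h h' e
        obtain ⟨rfl, rfl⟩ := e
        obtain ⟨_, rfl⟩ := h
        obtain ⟨_, rfl⟩ := h'
        rfl
      · rintro ⟨a, b, c⟩ h
        simp at h ⊢
        omega
      · rintro ⟨b, k⟩ _ hn
        rw [← PowerSeries.coeff_mul, coeff_shiftedVar_pow_eq_zero c c, zero_smul]
        by_contra hlt
        apply hn
        refine ⟨⟨b + k, b, k⟩, ?_, rfl⟩
        simp
        omega
      · rintro ⟨a, b, d⟩ h
        simp at h
        obtain ⟨_, rfl⟩ := h
        rw [← PowerSeries.coeff_mul, pow_add]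
    exact PowerSeries.ext hc
  map_zero' := by ext m; simp [shift]
  map_add' f g := by ext m; simp [shift, smul_add, Finset.sum_add_distrib]

@[simp]
theorem shiftHom_apply (c : ℂ) (f : R⟦X⟧) : shiftHom c f = shift c f := rfl

theorem constantCoeff_shift (c : ℂ) (f : R⟦X⟧) :
    PowerSeries.constantCoeff (shift c f) = PowerSeries.constantCoeff f := by
  rw [← PowerSeries.coeff_zero_eq_constantCoeff_apply, coeff_shift c f Nat.zero_lt_one]
  simp

end ShiftHom

/-! ### Alternating sums of noncommuting factors and Cramer's rule. -/

section FusedDeterminant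

variable {B : Type*} [Ring B] {ι : Type*}

/-- The signed sum over `ρ` of the products `y_0(ρ(0), b_0) y_1(ρ(1), b_1) ⋯`. -/
def fusedDet {n : ℕ} (y : Fin n → Fin n → ι → B) (b : Fin n → ι) : B :=
  ∑ ρ : Equiv.Perm (Fin n),
    (Equiv.Perm.sign ρ : ℤ) • (List.ofFn fun k => y k (ρ k) (b k)).prod

/-- The relation between consecutive factors which makes `fusedDet` alternating. -/
def IsFused {κ : Type*} (x y : κ → ι → B) : Prop :=
  ∀ a a' b b', x a b * y a' b' - x a' b * y a b' + x a b' * y a' b - x a' b' * y a b = 0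

theorem prod_ofFn_split {n : ℕ} (f : Fin (n + 1) → B) (i : Fin n) :
    (List.ofFn f).prod = ((List.ofFn f).take i).prod * (f i.castSucc * f i.succ) *
      ((List.ofFn f).drop (i + 2)).prod := by
  have h1 : (i : ℕ) < (List.ofFn f).length := by simp
  have h2 : (i : ℕ) + 1 < (List.ofFn f).length := by simp
  conv_lhs => rw [← List.take_append_drop i (List.ofFn f), List.prod_append,
    List.drop_eq_getElem_cons h1, List.drop_eq_getElem_cons h2, List.prod_cons, List.prod_cons]
  simp only [List.getElem_ofFn, mul_assoc]
  rfl

theorem prod_ofFn_split_congr {n : ℕ} (f g : Fin (n + 1) → B) (i : Fin n)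
    (h : ∀ k, k ≠ i.castSucc → k ≠ i.succ → g k = f k) :
    (List.ofFn g).prod = ((List.ofFn f).take i).prod * (g i.castSucc * g i.succ) *
      ((List.ofFn f).drop (i + 2)).prod := by
  have h1 : (List.ofFn g).take i = (List.ofFn f).take i := by
    apply List.ext_getElem
    · simp
    · intro k h1 h2
      simp only [List.length_take, List.length_ofFn] at h1
      simp only [List.getElem_take, List.getElem_ofFn]
      apply h <;> simp [Fin.ext_iff] <;> omega
  have h2 : (List.ofFn g).drop (i + 2) = (List.ofFn f).drop (i + 2) := by
    apply List.ext_getElem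
    · simp
    · intro k h1 h2
      simp only [List.getElem_drop, List.getElem_ofFn]
      apply h <;> simp [Fin.ext_iff] <;> omega
  rw [prod_ofFn_split g i, h1, h2]

/-- Permutations fixing `p` are permutations of its complement, with the same sign. It extracts the
smaller minor from a cofactor expansion. -/
theorem sum_perm_ite_fixed {n : ℕ} (p : Fin (n + 1)) (F : Equiv.Perm (Fin (n + 1)) → B)
    (G : Equiv.Perm (Fin n) → B)
    (hFG : ∀ ρ ρ', ρ p = p → (∀ k, ρ (p.succAbove k) = p.succAbove (ρ' k)) → F ρ = G ρ') :
    ∑ ρ : Equiv.Perm (Fin (n + 1)), (if ρ p = p then (Equiv.Perm.sign ρ : ℤ) • F ρ else 0) =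
      ∑ ρ' : Equiv.Perm (Fin n), (Equiv.Perm.sign ρ' : ℤ) • G ρ' := by
  rw [← Equiv.sum_comp (Equiv.Perm.decomposeOption.symm.trans (finSuccEquiv' p).symm.permCongr),
    Fintype.sum_prod_type, Fintype.sum_option]
  rw [Finset.sum_eq_zero (s := Finset.univ (α := Fin n)), add_zero]
  · refine Finset.sum_congr rfl fun ρ' _ => ?_
    rw [if_pos (by simp [Equiv.permCongr_apply])]
    congr 1
    · simp
    · apply hFG
      · simp [Equiv.permCongr_apply]
      · intro k
        simp [Equiv.permCongr_apply]
  · intro i _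
    refine Finset.sum_eq_zero fun ρ' _ => if_neg ?_
    simp [Equiv.permCongr_apply, Fin.succAbove_ne]

variable [Algebra ℂ B]

theorem eq_zero_of_add_self_eq_zero {x : B} (h : x + x = 0) : x = 0 := by
  have h2 : (2 : ℂ) • x = 0 := by rw [two_smul, h]
  rw [← one_smul ℂ x, ← inv_mul_cancel₀ (two_ne_zero' ℂ), mul_smul, h2, smul_zero]

/-- Pairing `ρ` with `ρ * τ` writes twice the sum of both sides as a sum over `ρ` whose terms each
contain, between unchanged outer factors, the four-term expression of `IsFused`. Division by 2
finishes. -/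
theorem fusedDet_comp_swap {n : ℕ} (y : Fin (n + 1) → Fin (n + 1) → ι → B) (i : Fin n)
    (hy : IsFused (y i.castSucc) (y i.succ)) (b : Fin (n + 1) → ι) :
    fusedDet y (b ∘ Equiv.swap i.castSucc i.succ) = -fusedDet y b := by
  set τ := Equiv.swap i.castSucc i.succ
  have hne : i.castSucc ≠ i.succ := by simp [Fin.ext_iff]
  let F : Equiv.Perm (Fin (n + 1)) → (Fin (n + 1) → ι) → B :=
    fun ρ b => (List.ofFn fun k => y k (ρ k) (b k)).prod
  have hF : ∀ b, fusedDet y b + fusedDet y b =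
      ∑ ρ : Equiv.Perm (Fin (n + 1)), (Equiv.Perm.sign ρ : ℤ) • (F ρ b - F (ρ * τ) b) := by
    intro b
    have : fusedDet y b = ∑ ρ : Equiv.Perm (Fin (n + 1)),
        -((Equiv.Perm.sign ρ : ℤ) • F (ρ * τ) b) := by
      rw [fusedDet, ← Equiv.sum_comp (Equiv.mulRight τ)]
      refine Finset.sum_congr rfl fun ρ _ => ?_
      simp [τ, Equiv.Perm.sign_mul, Equiv.Perm.sign_swap hne, F]
    conv_lhs => rw [this]; rhs; rw [← this, fusedDet]
    rw [← Finset.sum_add_distrib]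
    refine Finset.sum_congr rfl fun ρ _ => ?_
    rw [smul_sub]
    abel
  rw [eq_neg_iff_add_eq_zero]
  apply eq_zero_of_add_self_eq_zero
  have : fusedDet y (b ∘ τ) + fusedDet y b + (fusedDet y (b ∘ τ) + fusedDet y b) =
      (fusedDet y (b ∘ τ) + fusedDet y (b ∘ τ)) + (fusedDet y b + fusedDet y b) := by abel
  rw [this, hF, hF, ← Finset.sum_add_distrib]
  refine Finset.sum_eq_zero fun ρ _ => ?_
  rw [← smul_add]
  have hτ : ∀ k, k ≠ i.castSucc → k ≠ i.succ → τ k = k := fun k h1 h2 =>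
    Equiv.swap_apply_of_ne_of_ne h1 h2
  have h0 := prod_ofFn_split (fun k => y k (ρ k) (b k)) i
  have h1 := prod_ofFn_split_congr (fun k => y k (ρ k) (b k))
    (fun k => y k ((ρ * τ) k) (b k)) i fun k h1 h2 => by simp [hτ k h1 h2]
  have h2 := prod_ofFn_split_congr (fun k => y k (ρ k) (b k))
    (fun k => y k (ρ k) ((b ∘ τ) k)) i fun k h1 h2 => by simp [hτ k h1 h2]
  have h3 := prod_ofFn_split_congr (fun k => y k (ρ k) (b k))
    (fun k => y k ((ρ * τ) k) ((b ∘ τ) k)) i fun k h1 h2 => by simp [hτ k h1 h2]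
  have e1 : τ i.castSucc = i.succ := Equiv.swap_apply_left _ _
  have e2 : τ i.succ = i.castSucc := Equiv.swap_apply_right _ _
  simp only [F]
  rw [h0, h1, h2, h3]
  simp only [Equiv.Perm.mul_apply, Function.comp_apply, e1, e2]
  rw [← sub_mul, ← mul_sub, ← sub_mul, ← mul_sub, ← add_mul, ← mul_add]
  have := hy (ρ i.castSucc) (ρ i.succ) (b i.castSucc) (b i.succ)
  rw [show ∀ p q r s : B, p - q + (r - s) = r - s + p - q by intros; abel]
  rw [show ∀ p q r s : B, p - q + r - s = r - s + p - q by intros; abel] at this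
  rw [show ∀ p q r s : B, p - q + r - s = r - s + p - q by intros; abel, this]
  simp

theorem fusedDet_comp_perm {n : ℕ} (y : Fin (n + 1) → Fin (n + 1) → ι → B)
    (hy : ∀ i : Fin n, IsFused (y i.castSucc) (y i.succ)) (σ : Equiv.Perm (Fin (n + 1)))
    (b : Fin (n + 1) → ι) :
    fusedDet y (b ∘ σ) = (Equiv.Perm.sign σ : ℤ) • fusedDet y b := by
  have hσ : σ ∈ Submonoid.closure (Set.range fun i : Fin n => Equiv.swap i.castSucc i.succ) := by
    rw [Equiv.Perm.mclosure_swap_castSucc_succ]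
    trivial
  induction hσ using Submonoid.closure_induction generalizing b with
  | mem σ h =>
    obtain ⟨i, rfl⟩ := h
    have hne : i.castSucc ≠ i.succ := by simp [Fin.ext_iff]
    simp [fusedDet_comp_swap y i (hy i), Equiv.Perm.sign_swap hne]
  | one => simp
  | mul σ τ _ _ h1 h2 =>
    have : b ∘ ⇑(σ * τ) = (b ∘ σ) ∘ τ := rfl
    rw [this, h2, h1, smul_smul, Equiv.Perm.sign_mul, mul_comm]
    simp

theorem fusedDet_eq_zero {n : ℕ} (y : Fin (n + 1) → Fin (n + 1) → ι → B)
    (hy : ∀ i : Fin n, IsFused (y i.castSucc) (y i.succ)) (b : Fin (n + 1) → ι)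
    {i j : Fin (n + 1)} (hij : i ≠ j) (hb : b i = b j) : fusedDet y b = 0 := by
  have h := fusedDet_comp_perm y hy (Equiv.swap i j) b
  have hb' : b ∘ Equiv.swap i j = b := by
    funext k
    rw [Function.comp_apply, Equiv.swap_apply_def]
    split_ifs with h1 h2
    · rw [h1, hb]
    · rw [h2, hb]
    · rfl
  rw [hb', Equiv.Perm.sign_swap hij] at h
  apply eq_zero_of_add_self_eq_zero
  nth_rewrite 1 [h]
  simp

/-- Cramer's rule on the right: `w` is the last column of the inverse of the last factor's matrix,
so summing over the last column label collapses the last factor and forces `ρ` to fix the last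
index. -/
theorem fusedDet_mul_last {n : ℕ} (y : Fin (n + 1) → Fin (n + 1) → Fin (n + 1) → B)
    (hy : ∀ i : Fin n, IsFused (y i.castSucc) (y i.succ)) (w : Fin (n + 1) → B)
    (hw : ∀ a, ∑ c, y (Fin.last n) a c * w c = if a = Fin.last n then 1 else 0) :
    fusedDet y id * w (Fin.last n) =
      fusedDet (fun k a b => y k.castSucc a.castSucc (Fin.castSucc b)) (id : Fin n → Fin n) := by
  -- Every other label `c` repeats a column, so its term vanishes.
  have h1 : ∑ c, fusedDet y (Function.update id (Fin.last n) c) * w c =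
      fusedDet y id * w (Fin.last n) := by
    rw [Finset.sum_eq_single (Fin.last n)]
    · congr 2
      exact Function.update_eq_self _ _
    · intro c _ hc
      rw [fusedDet_eq_zero y hy _ (i := c) (j := Fin.last n) hc (by simp [hc]), zero_mul]
    · simp
  rw [← h1]
  simp only [fusedDet, Finset.sum_mul]
  rw [Finset.sum_comm, ← sum_perm_ite_fixed (Fin.last n)
    (F := fun ρ => (List.ofFn fun k : Fin n => y k.castSucc (ρ k.castSucc) k.castSucc).prod)]
  · refine Finset.sum_congr rfl fun ρ _ => ?_
    have : ∀ c, (List.ofFn fun k => y k (ρ k) (Function.update id (Fin.last n) c k)).prod * w c =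
        (List.ofFn fun k : Fin n => y k.castSucc (ρ k.castSucc) k.castSucc).prod *
          (y (Fin.last n) (ρ (Fin.last n)) c * w c) := by
      intro c
      rw [List.ofFn_succ', List.concat_eq_append, List.prod_append]
      simp [mul_assoc, Function.update_of_ne, Fin.castSucc_ne_last]
    simp only [smul_mul_assoc, this]
    rw [← Finset.smul_sum, ← Finset.mul_sum, hw]
    split_ifs <;> simp
  · intro ρ ρ' _ h
    congr 2
    funext k
    have := h k
    rw [Fin.succAbove_last] at this
    rw [this]
    rfl

/-- The mirror image on the left. The factor `t` is there because the required row of the inverse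
will be known only up to a left multiple. -/
theorem zero_mul_fusedDet {n : ℕ} (y : Fin (n + 1) → Fin (n + 1) → Fin (n + 1) → B)
    (hy : ∀ i : Fin n, IsFused (y i.castSucc) (y i.succ)) (v : Fin (n + 1) → B) (t : B)
    (hv : ∀ a, ∑ c, v c * y 0 a c = if a = 0 then t else 0) :
    v 0 * fusedDet y id =
      t * fusedDet (fun k a b => y k.succ a.succ (Fin.succ b)) (id : Fin n → Fin n) := by
  have h1 : ∑ c, v c * fusedDet y (Function.update id 0 c) = v 0 * fusedDet y id := by
    rw [Finset.sum_eq_single 0]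
    · congr 2
      exact Function.update_eq_self _ _
    · intro c _ hc
      rw [fusedDet_eq_zero y hy _ (i := c) (j := 0) hc (by simp [hc]), mul_zero]
    · simp
  rw [← h1]
  simp only [fusedDet, Finset.mul_sum]
  simp only [mul_smul_comm _ t]
  rw [Finset.sum_comm, ← sum_perm_ite_fixed 0
    (F := fun ρ => t * (List.ofFn fun k : Fin n => y k.succ (ρ k.succ) k.succ).prod)]
  · refine Finset.sum_congr rfl fun ρ _ => ?_
    have : ∀ c, v c * (List.ofFn fun k => y k (ρ k) (Function.update id 0 c k)).prod =
        (v c * y 0 (ρ 0) c) * (List.ofFn fun k : Fin n => y k.succ (ρ k.succ) k.succ).prod := by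
      intro c
      rw [List.ofFn_succ, List.prod_cons]
      simp [mul_assoc, Function.update_of_ne, Fin.succ_ne_zero]
    simp only [mul_smul_comm, this]
    rw [← Finset.smul_sum, ← Finset.sum_mul, hv]
    split_ifs <;> simp
  · intro ρ ρ' _ h
    congr 3
    funext k
    have := h k
    rw [Fin.succAbove_zero] at this
    rw [this]
    rfl

end FusedDeterminant

/-! ### The RTT relation in the super tensor square, and its consequences at unit shift. -/

section TensorSnd

variable {B : Type*} [Ring B] {I : Type*} [DecidableEq I]

/-- The matrix `1 ⊗ X`. -/
def tensorSnd (X : Matrix I I B) : Matrix (I × I) (I × I) B :=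
  Matrix.of fun a b => if a.1 = b.1 then X a.2 b.2 else 0

theorem tensorSnd_one : tensorSnd (1 : Matrix I I B) = 1 := by
  ext ⟨i, k⟩ ⟨j, l⟩
  by_cases h1 : i = j <;> by_cases h2 : k = l <;> simp [tensorSnd, Matrix.one_apply, h1, h2]

theorem tensorSnd_mul_tensorSnd [Fintype I] (X Y : Matrix I I B) :
    tensorSnd X * tensorSnd Y = tensorSnd (X * Y) := by
  ext ⟨i, k⟩ ⟨j, l⟩
  simp only [tensorSnd, Matrix.mul_apply, Matrix.of_apply, Fintype.sum_prod_type, ite_mul, mul_ite,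
    zero_mul, mul_zero]
  by_cases h : i = j <;> simp [h]

end TensorSnd

section RTT

variable {B : Type*} [Ring B] [Algebra ℂ B] {I J : Type*}

/-- The defining relation of the super Yangian for a family of matrices `X(u + p)`, `p ∈ ℂ`; the
parameter `ε` rescales the spectral parameter. -/
def IsRTT (par : I → ℕ) (ε : ℂ) (X : ℂ → Matrix I I B) : Prop :=
  ∀ p q i j k l,
    (p - q) • (X p i j * X q k l -
        (-1 : ℂ) ^ ((par i + par j) * (par k + par l)) • (X q k l * X p i j)) =
      ε • (-1 : ℂ) ^ (par i * par j + par i * par k + par j * par k) •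
        (X p k j * X q i l - X q k j * X p i l)

theorem IsRTT.submatrix {par : I → ℕ} {ε : ℂ} {X : ℂ → Matrix I I B} (h : IsRTT par ε X)
    (f : J → I) : IsRTT (par ∘ f) ε fun p => (X p).submatrix f f :=
  fun p q i j k l => h p q (f i) (f j) (f k) (f l)

section Tensor

variable [DecidableEq I]

/-- The matrix `X ⊗ 1` with the signs of the super tensor product. -/
def tensorFst (par : I → ℕ) (X : Matrix I I B) : Matrix (I × I) (I × I) B :=
  Matrix.of fun a b =>
    if a.2 = b.2 then (-1 : ℂ) ^ ((par a.1 + par b.1) * par a.2) • X a.1 b.1 else 0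

/-- The flip of the super tensor square. -/
def tensorFlip (par : I → ℕ) : Matrix (I × I) (I × I) B :=
  Matrix.of fun a b =>
    if a.2 = b.1 then if a.1 = b.2 then (-1 : ℂ) ^ (par a.1 * par a.2) • 1 else 0 else 0

theorem tensorFst_one (par : I → ℕ) : tensorFst par (1 : Matrix I I B) = 1 := by
  ext ⟨i, k⟩ ⟨j, l⟩
  by_cases h1 : i = j <;> by_cases h2 : k = l <;>
    simp [tensorFst, Matrix.one_apply, h1, h2, ← two_mul, mul_assoc]

variable [Fintype I]

theorem tensorFst_mul_tensorFst (par : I → ℕ) (X Y : Matrix I I B) :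
    tensorFst par X * tensorFst par Y = tensorFst par (X * Y) := by
  ext ⟨i, k⟩ ⟨j, l⟩
  simp only [tensorFst, Matrix.mul_apply, Matrix.of_apply, Fintype.sum_prod_type, ite_mul, mul_ite,
    zero_mul, mul_zero, Finset.sum_ite_eq', Finset.mem_univ, if_true]
  split_ifs with h
  · rw [Finset.smul_sum]
    refine Finset.sum_congr rfl fun m _ => ?_
    rw [smul_mul_smul_comm, ← pow_add]
    congr 1
    apply neg_one_pow_congr
    rw [h]
    by_cases Even (par l) <;> by_cases Even (par m) <;> simp [parity_simps, *, -Nat.not_even_iff_odd, not_iff_not]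
  · simp

theorem tensorFst_mul_tensorSnd_apply (par : I → ℕ) (X Y : Matrix I I B) (i k j l : I) :
    (tensorFst par X * tensorSnd Y) (i, k) (j, l) =
      (-1 : ℂ) ^ ((par i + par j) * par k) • (X i j * Y k l) := by
  simp [tensorFst, tensorSnd, Matrix.mul_apply, Fintype.sum_prod_type]

theorem tensorSnd_mul_tensorFst_apply (par : I → ℕ) (X Y : Matrix I I B) (i k j l : I) :
    (tensorSnd Y * tensorFst par X) (i, k) (j, l) =
      (-1 : ℂ) ^ ((par i + par j) * par l) • (Y k l * X i j) := by
  simp [tensorFst, tensorSnd, Matrix.mul_apply, Fintype.sum_prod_type]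

theorem tensorFlip_mul_apply (par : I → ℕ) (M : Matrix (I × I) (I × I) B) (i k j l : I) :
    ((tensorFlip par : Matrix (I × I) (I × I) B) * M) (i, k) (j, l) = (-1 : ℂ) ^ (par i * par k) • M (k, i) (j, l) := by
  simp [tensorFlip, Matrix.mul_apply, Fintype.sum_prod_type]

theorem mul_tensorFlip_apply (par : I → ℕ) (M : Matrix (I × I) (I × I) B) (i k j l : I) :
    (M * (tensorFlip par : Matrix (I × I) (I × I) B)) (i, k) (j, l) = (-1 : ℂ) ^ (par j * par l) • M (i, k) (l, j) := by
  simp [tensorFlip, Matrix.mul_apply, Fintype.sum_prod_type, mul_comm (par l)]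

/-- The matrix form $(p-q)[X_1,X_2]=\varepsilon(PX_1X_2-X_2X_1P)$; without indices it can be
multiplied by inverses. -/
theorem IsRTT.tensor {par : I → ℕ} (hpar : ∀ i, par i = 0 ∨ par i = 1) {ε : ℂ}
    {X : ℂ → Matrix I I B} (h : IsRTT par ε X) (p q : ℂ) :
    (p - q) • (tensorFst par (X p) * tensorSnd (X q) - tensorSnd (X q) * tensorFst par (X p)) =
      ε • (tensorFlip par * (tensorFst par (X p) * tensorSnd (X q)) -
        tensorSnd (X q) * tensorFst par (X p) * tensorFlip par) := by
  ext ⟨i, k⟩ ⟨j, l⟩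
  have h := h p q i j k l
  simp only [Matrix.smul_apply, Matrix.sub_apply, tensorFlip_mul_apply, mul_tensorFlip_apply,
    tensorFst_mul_tensorSnd_apply, tensorSnd_mul_tensorFst_apply]
  -- `s` is the sign by which the matrix entry differs from the indexed relation; the rest is a
  -- check over the sixteen parity patterns.
  obtain ⟨s, hs⟩ : ∃ s, s = (-1 : ℂ) ^ ((par i + par j) * par k) := ⟨_, rfl⟩
  rcases hpar i with hi | hi <;> rcases hpar j with hj | hj <;> rcases hpar k with hk | hk <;>
    rcases hpar l with hl | hl <;> simp only [hi, hj, hk, hl] at h hs ⊢ <;>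
    linear_combination (norm := (subst hs; module)) s • h

/-- Multiplying the matrix relation by $Y_1Y_2$ on the left and $Y_2Y_1$ on the right moves the flip
to the other side of each product, which amounts to reversing the sign of `ε`. -/
theorem IsRTT.inv {par : I → ℕ} (hpar : ∀ i, par i = 0 ∨ par i = 1) {ε : ℂ}
    {X Y : ℂ → Matrix I I B} (h : IsRTT par ε X) (hXY : ∀ p, X p * Y p = 1)
    (hYX : ∀ p, Y p * X p = 1) : IsRTT par (-ε) Y := by
  have key : ∀ p q, (p - q) • (tensorFst par (Y p) * tensorSnd (Y q) -
      tensorSnd (Y q) * tensorFst par (Y p)) =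
      ε • (tensorFst par (Y p) * tensorSnd (Y q) * tensorFlip par -
        tensorFlip par * (tensorSnd (Y q) * tensorFst par (Y p))) := by
    intro p q
    have h := h.tensor hpar p q
    have a1 : tensorFst par (X p) * tensorFst par (Y p) = 1 := by
      rw [tensorFst_mul_tensorFst, hXY, tensorFst_one]
    have a2 : tensorFst par (Y p) * tensorFst par (X p) = 1 := by
      rw [tensorFst_mul_tensorFst, hYX, tensorFst_one]
    have a3 : tensorSnd (X q) * tensorSnd (Y q) = 1 := by
      rw [tensorSnd_mul_tensorSnd, hXY, tensorSnd_one]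
    have a4 : tensorSnd (Y q) * tensorSnd (X q) = 1 := by
      rw [tensorSnd_mul_tensorSnd, hYX, tensorSnd_one]
    generalize tensorFst par (X p) = x₁ at *
    generalize tensorFst par (Y p) = y₁ at *
    generalize tensorSnd (X q) = x₂ at *
    generalize tensorSnd (Y q) = y₂ at *
    have e1 : x₁ * x₂ * (y₂ * y₁) = 1 := by
      rw [mul_assoc, ← mul_assoc x₂, a3, one_mul, a1]
    have e2 : y₁ * y₂ * (x₂ * x₁) = 1 := by
      rw [mul_assoc, ← mul_assoc y₂, a4, one_mul, a2]
    have h' := congrArg (fun z => y₁ * y₂ * z * (y₂ * y₁)) h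
    simp only [mul_smul_comm, smul_mul_assoc, mul_sub, sub_mul] at h'
    rw [mul_assoc _ (x₁ * x₂), e1, mul_one, e2, one_mul, ← mul_assoc _ (x₂ * x₁), e2, one_mul,
      mul_assoc _ (_ * _), mul_assoc _ (x₁ * x₂), e1, mul_one] at h'
    exact h'
  intro p q i j k l
  -- The two tensor factors and the two parameters are exchanged together, since the flip now stands
  -- on the opposite side.
  have h := congrFun (congrFun (key q p) (k, i)) (l, j)
  simp only [Matrix.smul_apply, Matrix.sub_apply, tensorFlip_mul_apply, mul_tensorFlip_apply,
    tensorFst_mul_tensorSnd_apply, tensorSnd_mul_tensorFst_apply] at h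
  obtain ⟨s, hs⟩ : ∃ s, s = (-1 : ℂ) ^ ((par k + par l) * par j) := ⟨_, rfl⟩
  rcases hpar i with hi | hi <;> rcases hpar j with hj | hj <;> rcases hpar k with hk | hk <;>
    rcases hpar l with hl | hl <;> simp only [hi, hj, hk, hl] at h hs ⊢ <;>
    linear_combination (norm := (subst hs; module)) s • h

end Tensor

/-- If `k` is even and `j` is odd, the two quasideterminants of the `2 × 2` block of `X` at
`(k, j)` are related by a unit shift. -/
theorem IsRTT.even_odd_exchange {par : I → ℕ} {X : ℂ → Matrix I I B} (h : IsRTT par (-1) X)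
    {k j : I} (hk : par k = 0) (hj : par j = 1) (w : ℂ) {a d : B} (ha : X (w + 1) k k * a = 1)
    (hd : d * X w j j = 1) :
    (X w k k - X w k j * d * X w j k) *
        (X (w + 1) j j - X (w + 1) j k * a * X (w + 1) k j) = X w j j * X (w + 1) k k := by
  have r1 := h w (w + 1) k k j k
  have r2 := h w (w + 1) j k j k
  have r4 := h (w + 1) w j j j k
  have r5 := h w (w + 1) k k j j
  have r6 := h w (w + 1) k j j k
  simp only [hk, hj] at r1 r2 r4 r5 r6
  norm_num at r1 r2 r4 r5 r6
  generalize X w k k = α₀ at *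
  generalize X w k j = β₀ at *
  generalize X w j k = γ₀ at *
  generalize X w j j = δ₀ at *
  generalize X (w + 1) k k = α₁ at *
  generalize X (w + 1) k j = β₁ at *
  generalize X (w + 1) j k = γ₁ at *
  generalize X (w + 1) j j = δ₁ at *
  -- Oddness makes the bracket an anticommutator, and at unit distance the relation reduces to
  -- $2\gamma_0\gamma_1=0$.
  have h1 : γ₀ * γ₁ = 0 := by
    apply eq_zero_of_add_self_eq_zero
    linear_combination (norm := abel) -r2
  have h2 : α₀ * (γ₁ * a * β₁) = γ₀ * β₁ := by
    rw [← mul_assoc, ← mul_assoc, r1, mul_assoc γ₀, ha, mul_one]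
  have h3 : β₀ * d * γ₀ * δ₁ = β₀ * γ₁ := by
    rw [mul_assoc, r4, mul_assoc, ← mul_assoc d, hd, one_mul]
  have h4 : β₀ * d * γ₀ * (γ₁ * a * β₁) = 0 := by
    rw [mul_assoc (β₀ * d), mul_assoc γ₁, ← mul_assoc γ₀, h1, zero_mul, mul_zero]
  rw [sub_mul, mul_sub, mul_sub, h2, h3, h4]
  linear_combination (norm := abel) r6 - r5

/-- When $p-q=1$, adding the relations for the column pairs $(b,b')$ and $(b',b)$ cancels all
products in the reversed order. -/
theorem IsRTT.isFused_rows {par : I → ℕ} {X : ℂ → Matrix I I B} (h : IsRTT par 1 X)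
    {e : J → I} (he : ∀ a, par (e a) = 0) (p : ℂ) :
    IsFused (fun a b => X p (e a) (e b)) (fun a b => X (p - 1) (e a) (e b)) := by
  intro a a' b b'
  have r1 := h p (p - 1) (e a) (e b) (e a') (e b')
  have r2 := h p (p - 1) (e a) (e b') (e a') (e b)
  simp only [he] at r1 r2
  norm_num at r1 r2
  linear_combination (norm := abel) r1 + r2

theorem IsRTT.isFused_columns {par : I → ℕ} {X : ℂ → Matrix I I B} (h : IsRTT par (-1) X)
    {e : J → I} (he : ∀ a, par (e a) = 1) (p : ℂ) :
    IsFused (fun a b => X p (e b) (e a)) (fun a b => X (p + 1) (e b) (e a)) := by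
  intro a a' b b'
  have r1 := h p (p + 1) (e b) (e a) (e b') (e a')
  have r2 := h p (p + 1) (e b) (e a') (e b') (e a)
  simp only [he] at r1 r2
  norm_num at r1 r2
  linear_combination (norm := abel) r2 - r1

end RTT

/-! ### Inverses of principal blocks and Schur complements. -/

section InverseOn

variable {B : Type*} [Ring B] {I : Type*} [DecidableEq I]

/-- The blocks of `A` and `G` with rows and columns in `S` are inverse to each other. -/
structure IsInvOn (S : Finset I) (A G : Matrix I I B) : Prop where
  mul_eq : ∀ i ∈ S, ∀ l ∈ S, ∑ j ∈ S, A i j * G j l = if i = l then 1 else 0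
  eq_mul : ∀ i ∈ S, ∀ l ∈ S, ∑ j ∈ S, G i j * A j l = if i = l then 1 else 0

theorem IsInvOn.solve {S : Finset I} {A G : Matrix I I B} (h : IsInvOn S A G) (z : I → B) {m : I}
    (hm : m ∈ S) : ∑ i ∈ S, G m i * ∑ l ∈ S, A i l * z l = z m := by
  simp only [Finset.mul_sum, ← mul_assoc]
  rw [Finset.sum_comm]
  simp only [← Finset.sum_mul]
  rw [Finset.sum_congr rfl fun l hl => by rw [h.eq_mul m hm l hl]]
  simp [hm]

/-- Passing to a smaller block is a Schur complement for the inverses. -/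
theorem IsInvOn.erase {S : Finset I} {A G H : Matrix I I B} {k j : I} (h : IsInvOn S A G)
    (h' : IsInvOn (S.erase k) A H) (hk : k ∈ S) (hj : j ∈ S) (hjk : j ≠ k) {a : B}
    (ha : a * G k k = 1) : H j j = G j j - G j k * a * G k j := by
  -- Column `j` of `H`, padded by zero at `k`. Then `A z` is the `j`-th unit vector except for an
  -- unknown entry `c` in row `k`, and `z k = 0` determines `c`.
  set z : I → B := fun l => if l = k then 0 else H l j with hz
  have hA : ∀ i, ∑ l ∈ S, A i l * z l = ∑ l ∈ S.erase k, A i l * H l j := by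
    intro i
    rw [← Finset.add_sum_erase S _ hk]
    simp only [hz, if_true, mul_zero, zero_add]
    refine Finset.sum_congr rfl fun l hl => ?_
    rw [if_neg (Finset.ne_of_mem_erase hl)]
  have hs : ∀ m ∈ S, z m = G m k * (∑ l ∈ S.erase k, A k l * H l j) + G m j := by
    intro m hm
    rw [← h.solve z hm, ← Finset.add_sum_erase S _ hk]
    simp only [hA]
    congr 1
    rw [Finset.sum_congr rfl fun i hi => by
      rw [h'.mul_eq i hi j (Finset.mem_erase.2 ⟨hjk, hj⟩)]]
    simp [hjk, hj]
  set c := ∑ l ∈ S.erase k, A k l * H l j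
  have h1 := hs k hk
  have h2 := hs j hj
  simp only [hz, if_true, if_neg hjk] at h1 h2
  have h3 : c = -(a * G k j) := by
    have := congrArg (a * ·) h1
    simp only [mul_zero, mul_add, ← mul_assoc, ha, one_mul] at this
    exact eq_neg_of_add_eq_zero_left this.symm
  rw [h2, h3, mul_neg, ← mul_assoc]
  abel

/-- If `G` inverts `A` on `K` and `Z` inverts it on `U ∪ {w}`, where `U` is the complement of
`W ∋ w` in `K`, then the row `w` of the inverse of the block `G` on `W` is proportional to
`∑_i Z(w, i) A(i, ·)`. -/
theorem IsInvOn.row {K S W : Finset I} {A G Z : Matrix I I B} (hK : IsInvOn K A G)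
    (hS : IsInvOn S A Z) (hSK : S ⊆ K) (hWK : W ⊆ K) {w : I} (hwS : w ∈ S) (hwW : w ∈ W)
    (hSW : ∀ x ∈ K, x ∈ S ↔ x ∉ W ∨ x = w) {m : I} (hm : m ∈ W) :
    ∑ l ∈ W, (∑ i ∈ S, Z w i * A i l) * G l m = if m = w then Z w w else 0 := by
  -- The added indices lie in `S` and differ from `w`, where the row `w` of `Z A` vanishes.
  have h1 : ∑ l ∈ W, (∑ i ∈ S, Z w i * A i l) * G l m =
      ∑ l ∈ K, (∑ i ∈ S, Z w i * A i l) * G l m := by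
    refine Finset.sum_subset hWK fun l hl hlW => ?_
    have hlS : l ∈ S := (hSW l hl).2 (Or.inl hlW)
    rw [hS.eq_mul w hwS l hlS]
    rw [if_neg (fun hwl : w = l => hlW (hwl ▸ hwW)), zero_mul]
  rw [h1]
  simp only [Finset.sum_mul, mul_assoc]
  rw [Finset.sum_comm]
  simp only [← Finset.mul_sum]
  rw [Finset.sum_congr rfl fun i hi => by rw [hK.mul_eq i (hSK hi) m (hWK hm)]]
  simp only [mul_ite, mul_one, mul_zero, Finset.sum_ite_eq']
  by_cases hmw : m = w
  · rw [if_pos hmw, hmw, if_pos hwS]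
  · rw [if_neg hmw, if_neg fun hmS => ((hSW m (hWK hm)).1 hmS).elim (fun h => h hm) hmw]

theorem IsInvOn.submatrix_mul {S : Finset I} {A G : Matrix I I B} (h : IsInvOn S A G) :
    A.submatrix (fun i : S => (i : I)) (fun i : S => (i : I)) *
      G.submatrix (fun i : S => (i : I)) (fun i : S => (i : I)) = 1 := by
  ext ⟨i, hi⟩ ⟨j, hj⟩
  rw [Matrix.mul_apply, Matrix.one_apply]
  simp only [Matrix.submatrix_apply, Subtype.mk.injEq]
  rw [← h.mul_eq i hi j hj]
  exact Finset.sum_coe_sort S fun l => A i l * G l j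

theorem IsInvOn.mul_submatrix {S : Finset I} {A G : Matrix I I B} (h : IsInvOn S A G) :
    G.submatrix (fun i : S => (i : I)) (fun i : S => (i : I)) *
      A.submatrix (fun i : S => (i : I)) (fun i : S => (i : I)) = 1 := by
  ext ⟨i, hi⟩ ⟨j, hj⟩
  rw [Matrix.mul_apply, Matrix.one_apply]
  simp only [Matrix.submatrix_apply, Subtype.mk.injEq]
  rw [← h.eq_mul i hi j hj]
  exact Finset.sum_coe_sort S fun l => G i l * A l j

theorem IsInvOn.map {S : Finset I} {A G : Matrix I I B} (h : IsInvOn S A G) {B' : Type*} [Ring B']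
    (f : B →+* B') : IsInvOn S (A.map f) (G.map f) where
  mul_eq i hi l hl := by
    have := congrArg f (h.mul_eq i hi l hl)
    simp only [map_sum, map_mul, apply_ite f, map_one, map_zero] at this
    exact this
  eq_mul i hi l hl := by
    have := congrArg f (h.eq_mul i hi l hl)
    simp only [map_sum, map_mul, apply_ite f, map_one, map_zero] at this
    exact this

end InverseOn

/-- Carries `a` through an ordered product, one crossing at a time. -/
theorem mul_prod_ofFn {B : Type*} [Ring B] {n : ℕ} (a : ℕ → B) (y z : Fin n → B)
    (h : ∀ p : Fin n, a p * y p = z p * a (p + 1)) :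
    a 0 * (List.ofFn y).prod = (List.ofFn z).prod * a n := by
  induction n generalizing a with
  | zero => simp
  | succ n ih =>
    have h0 := h 0
    simp only [Fin.val_zero, zero_add] at h0
    rw [List.ofFn_succ, List.ofFn_succ, List.prod_cons, List.prod_cons, ← mul_assoc, h0, mul_assoc,
      mul_assoc, ih (fun p => a (p + 1)) (fun p => y p.succ) (fun p => z p.succ) fun p => h p.succ]

/-! ### Growth of the superminor when one even or odd index is appended. -/

section GenericBerezinian

variable {B : Type*} [Ring B] [Algebra ℂ B] {I : Type*} [DecidableEq I]

/-- A family of matrices `T(u + p)` subject to the super Yangian relations, together with the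
inverses `G S p` of its principal blocks, whose diagonal entries are invertible. -/
structure IsInvertibleRTT (par : I → ℕ) (T : ℂ → Matrix I I B) (G : Finset I → ℂ → Matrix I I B) :
    Prop where
  par_eq : ∀ i, par i = 0 ∨ par i = 1
  rtt : IsRTT par 1 T
  inv : ∀ S p, IsInvOn S (T p) (G S p)
  isUnit : ∀ S p, ∀ i ∈ S, IsUnit (G S p i i)

/-- The quantum minor `∑_ρ sgn ρ t_{e_{ρ(0)}, e_0}(u) t_{e_{ρ(1)}, e_1}(u - 1) ⋯`. -/
def rowDet (T : ℂ → Matrix I I B) {n : ℕ} (e : Fin n → I) (u : ℂ) : B :=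
  fusedDet (fun k a b => T (u - (k : ℕ)) (e a) (e b)) id

/-- The quantum minor `∑_σ sgn σ x_{e_0, e_{σ(0)}}(v) x_{e_1, e_{σ(1)}}(v + 1) ⋯`. -/
def colDet (X : ℂ → Matrix I I B) {n : ℕ} (e : Fin n → I) (v : ℂ) : B :=
  fusedDet (fun k a b => X (v + (k : ℕ)) (e b) (e a)) id

/-- The elements of `K` which differ from `e_p, e_{p+1}, …`. -/
def truncate (K : Finset I) {n : ℕ} (e : Fin n → I) (p : ℕ) : Finset I :=
  K.filter fun x => ∀ q : Fin n, p ≤ q → x ≠ e q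

variable {par : I → ℕ} {T : ℂ → Matrix I I B} {G : Finset I → ℂ → Matrix I I B}

namespace IsInvertibleRTT

theorem rtt_inv (h : IsInvertibleRTT par T G) (K : Finset I) :
    IsRTT (fun i : K => par i) (-1) fun p => (G K p).submatrix (fun i : K => (i : I)) (fun i : K => (i : I)) :=
  IsRTT.inv (par := fun i : K => par i) (fun i => h.par_eq i)
    (h.rtt.submatrix fun i : K => (i : I)) (fun p => (h.inv K p).submatrix_mul)
    fun p => (h.inv K p).mul_submatrix

/-- By the Schur complement formula, both factors on the left are quasideterminants of the
$2\times2$ block of `G S` at `k`, `j`. -/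
theorem exchange (h : IsInvertibleRTT par T G) {S : Finset I} {k j : I} (hkS : k ∈ S) (hjS : j ∈ S)
    (hk : par k = 0) (hj : par j = 1) (w : ℂ) :
    G (S.erase j) w k k * G (S.erase k) (w + 1) j j = G S w j j * G S (w + 1) k k := by
  have hjk : j ≠ k := by
    rintro rfl
    omega
  have h1 := (h.inv S (w + 1)).erase (h.inv (S.erase k) (w + 1)) hkS hjS hjk
    (Ring.inverse_mul_cancel _ (h.isUnit S (w + 1) k hkS))
  have h2 := (h.inv S w).erase (h.inv (S.erase j) w) hjS hkS hjk.symm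
    (Ring.inverse_mul_cancel _ (h.isUnit S w j hjS))
  rw [h1, h2]
  exact (h.rtt_inv S).even_odd_exchange (k := ⟨k, hkS⟩) (j := ⟨j, hjS⟩) hk hj w
    (Ring.mul_inverse_cancel _ (h.isUnit S (w + 1) k hkS))
    (Ring.inverse_mul_cancel _ (h.isUnit S w j hjS))

theorem rowDet_succ (h : IsInvertibleRTT par T G) {n : ℕ} {e : Fin (n + 1) → I}
    (he : Function.Injective e) (hpar : ∀ a, par (e a) = 0) (u : ℂ) :
    rowDet T e u * G (Finset.univ.image e) (u - n) (e (Fin.last n)) (e (Fin.last n)) =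
      rowDet T (e ∘ Fin.castSucc) u := by
  refine fusedDet_mul_last (fun k a b => T (u - (k : ℕ)) (e a) (e b)) (fun i => ?_)
    (fun c => G (Finset.univ.image e) (u - n) (e c) (e (Fin.last n))) fun a => ?_
  · have := h.rtt.isFused_rows hpar (u - (i : ℕ))
    rwa [sub_sub, ← Nat.cast_succ] at this
  · have := (h.inv (Finset.univ.image e) (u - n)).mul_eq (e a) (by simp) (e (Fin.last n)) (by simp)
    rw [Finset.sum_image he.injOn] at this
    simpa [he.eq_iff] using this

theorem colDet_succ (h : IsInvertibleRTT par T G) {n : ℕ} {e : Fin (n + 1) → I}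
    (he : Function.Injective e) (hpar : ∀ a, par (e a) = 1) {K : Finset I} (heK : ∀ a, e a ∈ K)
    (v : ℂ) :
    colDet (G K) e v = G (truncate K e 1) v (e 0) (e 0) * colDet (G K) (e ∘ Fin.succ) (v + 1) := by
  have h0 : e 0 ∈ truncate K e 1 := by
    rw [truncate, Finset.mem_filter]
    refine ⟨heK 0, fun q hq h => ?_⟩
    rw [← he h] at hq
    simp at hq
  have key := zero_mul_fusedDet (fun k a b => G K (v + (k : ℕ)) (e b) (e a)) (fun i => ?_)
    (fun c => ∑ i ∈ truncate K e 1, G (truncate K e 1) v (e 0) i * T v i (e c))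
    (G (truncate K e 1) v (e 0) (e 0)) fun a => ?_
  -- The row vector has entry 1 at `e 0`, so no factor remains in front of the full sum.
  · rw [(h.inv _ v).eq_mul _ h0 _ h0, if_pos rfl, one_mul] at key
    rw [colDet, key, colDet]
    congr 2
    funext k a b
    simp only [Fin.val_succ, Function.comp_apply]
    congr 1
    push_cast
    ring
  · have := (h.rtt_inv K).isFused_columns (e := fun a => (⟨e a, heK a⟩ : K)) hpar (v + (i : ℕ))
    rwa [add_assoc, ← Nat.cast_succ] at this
  · have := (h.inv K v).row (h.inv (truncate K e 1) v) (W := Finset.univ.image e)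
      (Finset.filter_subset _ _) (by simpa [Finset.image_subset_iff] using heK) h0 (by simp)
      (fun x hx => ?_) (m := e a) (by simp)
    · rw [Finset.sum_image he.injOn] at this
      simpa [he.eq_iff] using this
    · simp only [truncate, Finset.mem_filter, hx, true_and, Finset.mem_image, Finset.mem_univ,
        not_exists, Fin.forall_fin_succ]
      simp only [Fin.val_zero, Fin.val_succ]
      by_cases hx0 : x = e 0
      · subst hx0
        simp [he.eq_iff, (Fin.succ_ne_zero _).symm]
      · simp [hx0, Ne.symm hx0, eq_comm]

/-- The block of the `p`-th factor contains `e 0, …, e p` and every element of `K` outside the range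
of `e`, but no later `e q`. -/
theorem colDet_eq_prod (h : IsInvertibleRTT par T G) {n : ℕ} {e : Fin n → I}
    (he : Function.Injective e) (hpar : ∀ a, par (e a) = 1) {K : Finset I} (heK : ∀ a, e a ∈ K)
    (v : ℂ) :
    colDet (G K) e v =
      (List.ofFn fun p : Fin n => G (truncate K e (p + 1)) (v + (p : ℕ)) (e p) (e p)).prod := by
  induction n generalizing v with
  | zero => simp [colDet, fusedDet]
  | succ n ih =>
    rw [h.colDet_succ he hpar heK, ih (he.comp (Fin.succ_injective n)) (fun a => hpar _)
      (fun a => heK _), List.ofFn_succ, List.prod_cons]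
    congr 2
    · simp
    · congr 1
      funext p
      have h1 : truncate K (e ∘ Fin.succ) (p + 1) = truncate K e (p.succ + 1) := by
        ext x
        simp [truncate, Fin.forall_fin_succ]
      have h2 : v + 1 + ((p : ℕ) : ℂ) = v + ((p.succ : ℕ) : ℂ) := by
        push_cast [Fin.val_succ]
        ring
      rw [h1, h2]
      rfl

theorem even_step (h : IsInvertibleRTT par T G) {m n : ℕ} {f : Fin (m + 1) → I} {e : Fin n → I}
    (hf : Function.Injective f) (he : Function.Injective e) (hparf : ∀ a, par (f a) = 0)
    (hpare : ∀ a, par (e a) = 1) {K : Finset I} (heK : ∀ a, e a ∈ K)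
    (hfK : truncate K e 0 = Finset.univ.image f) (u : ℂ) :
    rowDet T f u * colDet (G K) e (u - m) =
      rowDet T (f ∘ Fin.castSucc) u * colDet (G (K.erase (f (Fin.last m)))) e (u - m + 1) *
        Ring.inverse (G K (u - m + n) (f (Fin.last m)) (f (Fin.last m))) := by
  set k := f (Fin.last m) with hk
  have hfe : ∀ q, k ≠ e q := fun q hq => by
    have h1 := hparf (Fin.last m)
    have h2 := hpare q
    rw [← hk, hq] at h1
    omega
  have hkK : k ∈ K := (Finset.filter_subset _ _) (hfK ▸ Finset.mem_image_of_mem f (Finset.mem_univ _) :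
    k ∈ truncate K e 0)
  have hkU : ∀ p, k ∈ truncate K e p := fun p =>
    Finset.mem_filter.2 ⟨hkK, fun q _ => hfe q⟩
  have hn : truncate K e n = K := Finset.filter_true_of_mem fun x _ q hq => absurd q.2 (by omega)
  -- The inverse pivot at `k` starts with the block free of all `e q` and ends with `K`; the odd
  -- factors lose `k` from their blocks and gain one in their arguments.
  have hchain := mul_prod_ofFn (n := n)
    (fun p => Ring.inverse (G (truncate K e p) (u - m + p) k k))
    (fun p => G (truncate K e (p + 1)) (u - m + (p : ℕ)) (e p) (e p))
    (fun p => G (truncate (K.erase k) e (p + 1)) (u - m + 1 + (p : ℕ)) (e p) (e p)) fun p => ?_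
  · rw [h.colDet_eq_prod he hpare heK,
      h.colDet_eq_prod he hpare (fun a => Finset.mem_erase.2 ⟨(hfe a).symm, heK a⟩),
      ← h.rowDet_succ hf hparf, mul_assoc, mul_assoc]
    rw [hn] at hchain
    rw [← hchain, Nat.cast_zero, add_zero, ← hfK, ← mul_assoc _ (Ring.inverse _),
      Ring.mul_inverse_cancel _ (h.isUnit _ _ _ (hkU 0)), one_mul]
  · have hU : (truncate K e (p + 1)).erase (e p) = truncate K e p := by
      ext x
      simp only [truncate, Finset.mem_erase, Finset.mem_filter]
      constructor
      · rintro ⟨h1, h2, h3⟩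
        refine ⟨h2, fun q hq => ?_⟩
        rcases eq_or_lt_of_le hq with h4 | h4
        · rwa [← Fin.ext h4]
        · exact h3 q h4
      · rintro ⟨h1, h2⟩
        exact ⟨h2 p le_rfl, h1, fun q hq => h2 q (by omega)⟩
    have hU' : (truncate K e (p + 1)).erase k = truncate (K.erase k) e (p + 1) := by
      ext x
      simp only [truncate, Finset.mem_erase, Finset.mem_filter, and_assoc]
    have hep : e p ∈ truncate K e (p + 1) := by
      refine Finset.mem_filter.2 ⟨heK p, fun q hq hpq => ?_⟩
      rw [he hpq] at hq
      omega
    have hex := h.exchange (hkU (p + 1)) hep (hparf _) (hpare p) (u - m + (p : ℕ))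
    rw [hU, hU'] at hex
    have e1 : u - m + (((p : ℕ) + 1 : ℕ) : ℂ) = u - m + (p : ℕ) + 1 := by push_cast; ring
    have e2 : u - (m : ℂ) + 1 + ((p : ℕ) : ℂ) = u - m + (p : ℕ) + 1 := by ring
    simp only [e1, e2]
    have u1 := h.isUnit _ (u - m + (p : ℕ)) _ (hkU p)
    have u2 := h.isUnit _ (u - m + (p : ℕ) + 1) _ (hkU (p + 1))
    rw [Ring.inverse_mul_eq_iff_eq_mul _ _ _ u1, ← mul_assoc, hex, mul_assoc,
      Ring.mul_inverse_cancel _ u2, mul_one]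

/-- Only the last factor of the product has a block containing the last odd index. -/
theorem odd_step (h : IsInvertibleRTT par T G) {n : ℕ} {e : Fin (n + 1) → I}
    (he : Function.Injective e) (hpar : ∀ a, par (e a) = 1) {K : Finset I} (heK : ∀ a, e a ∈ K)
    (v : ℂ) :
    colDet (G K) e v = colDet (G (K.erase (e (Fin.last n)))) (e ∘ Fin.castSucc) v *
      G K (v + n) (e (Fin.last n)) (e (Fin.last n)) := by
  rw [h.colDet_eq_prod he hpar heK, h.colDet_eq_prod (he.comp (Fin.castSucc_injective n))
    (fun a => hpar _) (K := K.erase (e (Fin.last n)))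
    (fun a => Finset.mem_erase.2 ⟨fun hh => (Fin.castSucc_lt_last a).ne (he hh), heK _⟩),
    List.ofFn_succ', List.concat_eq_append, List.prod_append, List.prod_singleton]
  congr 1
  · congr 2
    funext p
    have : truncate K e (p.castSucc + 1) =
        truncate (K.erase (e (Fin.last n))) (e ∘ Fin.castSucc) (p + 1) := by
      ext x
      have hp : (p : ℕ) + 1 ≤ n := p.2
      simp only [truncate, Finset.mem_erase, Finset.mem_filter, Fin.forall_fin_succ',
        Function.comp_apply, Fin.val_castSucc, Fin.val_last, hp, forall_const]
      tauto
    rw [this]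
    rfl
  · have : truncate K e (Fin.last n + 1) = K :=
      Finset.filter_true_of_mem fun x _ q hq => absurd q.2 (by simp at hq; omega)
    rw [this, Fin.val_last]

end IsInvertibleRTT

end GenericBerezinian

/-! ### The super Yangian as an instance, and bookkeeping of positions and offsets. -/

section Concrete

variable {n : ℕ}

theorem t_zero (s : Fin n → Fin 2) (i j : Fin n) : t s i j 0 = if i = j then 1 else 0 := by
  by_cases h : i = j <;> simp [t, freeT, h]

/-- The relations persist when `p` or `q` is 0, both sides being zero; this supplies the edge terms
of the double series. -/
theorem supercommutator_t (s : Fin n → Fin 2) (i j k l : Fin n) (p q : ℕ) :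
    t s i j p * t s k l q -
        (-1 : ℂ) ^ (((s i : ℕ) + (s j : ℕ)) * ((s k : ℕ) + (s l : ℕ))) • (t s k l q * t s i j p) =
      (-1 : ℂ) ^ ((s i : ℕ) * (s j : ℕ) + (s i : ℕ) * (s k : ℕ) + (s j : ℕ) * (s k : ℕ)) •
        ∑ r ∈ Finset.range (min p q),
          (t s k j r * t s i l (p + q - 1 - r) - t s k j (p + q - 1 - r) * t s i l r) := by
  have hsmul : ∀ (m : ℕ) (x : Yangian s), (-1 : ℂ) ^ m • x = (-1) ^ m * x := by
    intro m x
    rw [Algebra.smul_def, map_pow, map_neg, map_one]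
  have hdiag : ∀ (a : Fin n) (m : ℕ), (-1 : ℂ) ^ (((s a : ℕ) + (s a : ℕ)) * m) = 1 := by
    intro a m
    rw [← two_mul, mul_assoc, pow_mul]
    simp
  rcases Nat.eq_zero_or_pos p with rfl | hp
  · rw [Nat.zero_min, Finset.range_zero, Finset.sum_empty, smul_zero, t_zero]
    by_cases h : i = j
    · subst h
      rw [hdiag]
      simp
    · simp [h]
  rcases Nat.eq_zero_or_pos q with rfl | hq
  · rw [Nat.min_zero, Finset.range_zero, Finset.sum_empty, smul_zero, t_zero]
    by_cases h : k = l
    · subst h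
      rw [mul_comm, hdiag]
      simp
    · simp [h]
  have h := RingQuot.mkAlgHom_rel ℂ (Rel.rtt (s := s) i j k l p q hp hq)
  simp only [map_sub, map_mul, map_pow, map_neg, map_one, map_sum, parity] at h
  rw [hsmul, hsmul]
  exact h

/-- The matrix `T(u + p)`. -/
def shiftedT (s : Fin n → Fin 2) (p : ℂ) : Matrix (Fin n) (Fin n) (Yangian s)⟦X⟧ :=
  (T s).map (shiftHom p)

theorem isRTT_shiftedT (s : Fin n → Fin 2) :
    IsRTT (fun i => (s i : ℕ)) 1 (shiftedT s) := by
  intro p q i j k l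
  have hT : ∀ i j r, PowerSeries.coeff r (T s i j) = t s i j r := fun i j r => by simp [T]
  simp only [shiftedT, Matrix.map_apply, shiftHom_apply, shift_mul_shift, hT]
  rw [doubleSeries_swap p q fun r m => t s k l m * t s i j r,
    doubleSeries_swap p q fun r m => t s k j m * t s i l r, one_smul,
    ← doubleSeries_smul p q ((-1) ^ (((s i : ℕ) + (s j : ℕ)) * ((s k : ℕ) + (s l : ℕ)))),
    ← doubleSeries_sub, ← doubleSeries_sub, ← doubleSeries_smul p q
      ((-1) ^ ((s i : ℕ) * (s j : ℕ) + (s i : ℕ) * (s k : ℕ) + (s j : ℕ) * (s k : ℕ)))]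
  have hc := supercommutator_t s i j k l
  apply smul_doubleSeries_eq
  · intro r
    rw [hc]
    simp
  · intro r
    rw [hc]
    simp
  · intro r m
    rw [hc, hc]
    refine (smul_sub (A := Yangian s) (_ : ℂ) _ _).symm.trans (congrArg _ ?_)
    rw [show r + 1 + m - 1 = r + m by omega, show r + (m + 1) - 1 = r + m by omega]
    -- Both brackets have the same total degree, so the two sums differ by at most one term; for `r
    -- = m` they coincide, as the right-hand side vanishes.
    rcases lt_trichotomy r m with h | h | h
    · rw [min_eq_left (by omega : r + 1 ≤ m), min_eq_left (by omega : r ≤ m + 1),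
        Finset.sum_range_succ, add_sub_cancel_left, Nat.add_sub_cancel_left]
    · subst h
      rw [min_eq_right (by omega : r ≤ r + 1), min_eq_left (by omega : r ≤ r + 1)]
      simp
    · rw [min_eq_right (by omega : m ≤ r + 1), min_eq_right (by omega : m + 1 ≤ r),
        Finset.sum_range_succ, Nat.add_sub_cancel]
      abel

/-- The matrix with block `A` on `S` and identity block on the complement of `S`. -/
def blockExtend {R : Type*} [Ring R] (S : Finset (Fin n)) (A : Matrix (Fin n) (Fin n) R) :
    Matrix (Fin n) (Fin n) R :=
  Matrix.of fun i j => if i ∈ S ∧ j ∈ S then A i j else if i = j then 1 else 0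

section Block

variable {R : Type*} [Ring R] {A : Matrix (Fin n) (Fin n) R⟦X⟧}

theorem isOneModX_blockExtend (hA : IsOneModX A) (S : Finset (Fin n)) :
    IsOneModX (blockExtend S A) := by
  intro i j
  rw [blockExtend, Matrix.of_apply]
  split_ifs with h1 h2 h2
  · rw [hA, if_pos h2]
  · rw [hA, if_neg h2]
  · exact map_one _
  · exact map_zero _

/-- The extension is block diagonal, so its inverse restricts to the inverse of the block. All
principal blocks, not only leading ones, thus get inverses indexed by the same `Fin n`. -/
theorem isInvOn_blockExtend (hA : IsOneModX A) (S : Finset (Fin n)) :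
    IsInvOn S A (Ring.inverse (blockExtend S A)) := by
  have hu := isUnit_of_isOneModX (isOneModX_blockExtend hA S)
  have h1 := Ring.mul_inverse_cancel _ hu
  have h2 := Ring.inverse_mul_cancel _ hu
  generalize Ring.inverse (blockExtend S A) = W at *
  have hin : ∀ i ∈ S, ∀ j ∈ S, blockExtend S A i j = A i j := fun i hi j hj => if_pos ⟨hi, hj⟩
  have hout : ∀ i j, i ∈ S ∧ j ∉ S ∨ i ∉ S ∧ j ∈ S → blockExtend S A i j = 0 := by
    intro i j h
    have h1 : ¬(i ∈ S ∧ j ∈ S) := by tauto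
    have h2 : i ≠ j := by
      rintro rfl
      tauto
    rw [blockExtend, Matrix.of_apply, if_neg h1, if_neg h2]
  constructor
  · intro i hi l _
    have := congrFun (congrFun h1 i) l
    rw [Matrix.mul_apply, Matrix.one_apply] at this
    rw [← this, ← Finset.sum_subset (Finset.subset_univ S) fun j _ hj => by
      rw [hout i j (Or.inl ⟨hi, hj⟩), zero_mul]]
    exact Finset.sum_congr rfl fun j hj => by rw [hin i hi j hj]
  · intro i _ l hl
    have := congrFun (congrFun h2 i) l
    rw [Matrix.mul_apply, Matrix.one_apply] at this
    rw [← this, ← Finset.sum_subset (Finset.subset_univ S) fun j _ hj => by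
      rw [hout j l (Or.inr ⟨hj, hl⟩), mul_zero]]
    exact Finset.sum_congr rfl fun j hj => by rw [hin j hj l hl]

theorem constantCoeff_inverse_blockExtend (hA : IsOneModX A) (S : Finset (Fin n)) (i : Fin n) :
    PowerSeries.constantCoeff (Ring.inverse (blockExtend S A) i i) = 1 := by
  have hM : (blockExtend S A).map (PowerSeries.constantCoeff (R := R)) = 1 := by
    ext i j
    rw [Matrix.map_apply, isOneModX_blockExtend hA, Matrix.one_apply]
  have h := Ring.mul_inverse_cancel _ (isUnit_of_isOneModX (isOneModX_blockExtend hA S))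
  have h' := congrArg (fun M => M.map (PowerSeries.constantCoeff (R := R))) h
  simp only [Matrix.map_mul, hM, one_mul] at h'
  have := congrFun (congrFun h' i) i
  simpa using this

/-- The inverse of the pivot `d_k` is the last diagonal entry of the inverse of the leading
block. -/
theorem IsGaussDecomposition.inv_mul {F E G : Matrix (Fin n) (Fin n) R⟦X⟧} {d : Fin n → R⟦X⟧}
    (h : IsGaussDecomposition A F d E) {S : Finset (Fin n)} {k : Fin n}
    (hS : ∀ i, i ∈ S ↔ i ≤ k) (hG : IsInvOn S A G) : G k k * d k = 1 := by
  -- Row `k` of `G F D`. Its product with `E` is a unit vector in the columns up to `k`;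
  -- triangularity of `E` passes this to `y`, and triangularity of `F` reduces `y k` to `G k k * d
  -- k`.
  set y : Fin n → R⟦X⟧ := fun i => ∑ l ∈ S, G k l * (F l i * d i) with hy
  have hyE : ∀ j ≤ k, ∑ i, y i * E i j = if k = j then 1 else 0 := by
    intro j hj
    rw [← hG.eq_mul k ((hS k).2 le_rfl) j ((hS j).2 hj)]
    simp only [hy, Finset.sum_mul]
    rw [Finset.sum_comm]
    refine Finset.sum_congr rfl fun l _ => ?_
    rw [h.eq_mul, Matrix.mul_apply, Finset.mul_sum]
    refine Finset.sum_congr rfl fun i _ => ?_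
    rw [Matrix.mul_diagonal, mul_assoc]
  have hy0 : ∀ m : ℕ, ∀ j : Fin n, (j : ℕ) = m → j ≤ k → y j = if k = j then 1 else 0 := by
    intro m
    induction m using Nat.strong_induction_on with
    | _ m ih =>
      rintro j rfl hj
      rw [← hyE j hj, Finset.sum_eq_single j]
      · rw [h.upper_diag, mul_one]
      · intro i _ hij
        rcases lt_or_gt_of_ne hij with hlt | hgt
        · rw [ih i hlt i rfl (hlt.le.trans hj), if_neg (hlt.trans_le hj).ne', zero_mul]
        · rw [h.upper_zero i j hgt, mul_zero]
      · simp
  have hk := hy0 k k rfl le_rfl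
  rw [if_pos rfl] at hk
  rw [← hk, hy]
  simp only
  rw [Finset.sum_eq_single k]
  · rw [h.lower_diag, one_mul]
  · intro l hl hlk
    rw [h.lower_zero l k (lt_of_le_of_ne ((hS l).1 hl) hlk), zero_mul, mul_zero]
  · intro hk
    exact absurd ((hS k).2 le_rfl) hk

end Block

/-- The inverses of the principal blocks of `T(u + p)`. -/
def shiftedInv (s : Fin n → Fin 2) (S : Finset (Fin n)) (p : ℂ) :
    Matrix (Fin n) (Fin n) (Yangian s)⟦X⟧ :=
  (Ring.inverse (blockExtend S (T s))).map (shiftHom p)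

theorem isInvertibleRTT (s : Fin n → Fin 2) :
    IsInvertibleRTT (fun i => (s i : ℕ)) (shiftedT s) (shiftedInv s) where
  par_eq i := by omega
  rtt := isRTT_shiftedT s
  inv S p := (isInvOn_blockExtend (isOneModX_T s) S).map (shiftHom p)
  isUnit S p i _ := isUnit_of_constantCoeff_one (by
    rw [shiftedInv, Matrix.map_apply, shiftHom_apply, constantCoeff_shift,
      constantCoeff_inverse_blockExtend (isOneModX_T s)])

/-- The set of the first `k` indices. -/
def leading (n k : ℕ) : Finset (Fin n) := Finset.univ.filter fun x => (x : ℕ) < k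

theorem shiftedInv_leading (s : Fin n → Fin 2) (k : Fin n) (p : ℂ) :
    shiftedInv s (leading n (k + 1)) p k k = shift p (Ring.inverse (d s k)) := by
  obtain ⟨F, E, hG, hu⟩ := d_spec s
  have h := hG.inv_mul (S := leading n (k + 1)) (k := k)
    (fun i => by simp [leading])
    (isInvOn_blockExtend (isOneModX_T s) _)
  rw [shiftedInv, Matrix.map_apply, shiftHom_apply]
  congr 1
  rw [← one_mul (Ring.inverse (d s k)), ← h, mul_assoc, Ring.mul_inverse_cancel _ (hu k), mul_one]

theorem ring_inverse_leadingT (s : Fin n → Fin 2) (k : ℕ) (hk : k ≤ n) (i j : Fin k) :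
    Ring.inverse (leadingT s k hk) i j =
      Ring.inverse (blockExtend (leading n k) (T s)) (Fin.castLE hk i) (Fin.castLE hk j) := by
  have hW := isInvOn_blockExtend (isOneModX_T s) (leading n k)
  generalize Ring.inverse (blockExtend (leading n k) (T s)) = W at *
  have hmem : ∀ i : Fin k, Fin.castLE hk i ∈ leading n k := fun i => by simp [leading]
  have himg : leading n k = Finset.univ.map (Fin.castLEEmb hk) := by
    ext x
    simp only [leading, Finset.mem_filter, Finset.mem_univ, true_and, Finset.mem_map]
    exact ⟨fun hx => ⟨⟨x, hx⟩, rfl⟩, by rintro ⟨a, rfl⟩; exact a.2⟩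
  have h1 : leadingT s k hk * W.submatrix (Fin.castLE hk) (Fin.castLE hk) = 1 := by
    ext1 i j
    have := hW.mul_eq _ (hmem i) _ (hmem j)
    rw [himg, Finset.sum_map] at this
    rw [Matrix.mul_apply, Matrix.one_apply]
    simpa [leadingT] using this
  have h2 := congrArg (Ring.inverse (leadingT s k hk) * ·) h1
  simp only [← mul_assoc, Ring.inverse_mul_cancel _ (isUnit_leadingT s k hk), one_mul,
    mul_one] at h2
  rw [← h2]
  rfl

/-- `f` enumerates increasingly the positions of the digit `a` among the first `k` digits. -/
structure IsEnumeration (s : Fin n → Fin 2) (a : Fin 2) (k : ℕ) {m : ℕ} (f : Fin m → Fin n) :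
    Prop where
  strictMono : StrictMono f
  mem_iff : ∀ x : Fin n, (∃ i, f i = x) ↔ (x : ℕ) < k ∧ s x = a

namespace IsEnumeration

variable {s : Fin n → Fin 2} {a : Fin 2} {k m : ℕ} {f : Fin m → Fin n}

theorem lt (h : IsEnumeration s a k f) (i : Fin m) : (f i : ℕ) < k :=
  ((h.mem_iff _).1 ⟨i, rfl⟩).1

theorem digit (h : IsEnumeration s a k f) (i : Fin m) : s (f i) = a :=
  ((h.mem_iff _).1 ⟨i, rfl⟩).2

theorem snoc (h : IsEnumeration s a k f) (hk : k < n) (ha : s ⟨k, hk⟩ = a) :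
    IsEnumeration s a (k + 1) (Fin.snoc f ⟨k, hk⟩ : Fin (m + 1) → Fin n) where
  strictMono := by
    intro i j hij
    induction j using Fin.lastCases with
    | last =>
      induction i using Fin.lastCases with
      | last => exact absurd hij (lt_irrefl _)
      | cast i =>
        rw [Fin.snoc_castSucc, Fin.snoc_last]
        exact h.lt i
    | cast j =>
      induction i using Fin.lastCases with
      | last => exact absurd hij (not_lt.2 (Fin.le_last _))
      | cast i =>
        rw [Fin.snoc_castSucc, Fin.snoc_castSucc]
        exact h.strictMono hij
  mem_iff x := by
    rw [Fin.exists_fin_succ']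
    simp only [Fin.snoc_castSucc, Fin.snoc_last, h.mem_iff]
    constructor
    · rintro (⟨h1, h2⟩ | rfl)
      · exact ⟨by omega, h2⟩
      · exact ⟨Nat.lt_succ_self k, ha⟩
    · rintro ⟨h1, h2⟩
      rcases Nat.lt_succ_iff_lt_or_eq.1 h1 with h3 | h3
      · exact Or.inl ⟨h3, h2⟩
      · exact Or.inr (Fin.ext h3.symm)

theorem succ (h : IsEnumeration s a k f) (hk : k < n) (ha : s ⟨k, hk⟩ ≠ a) :
    IsEnumeration s a (k + 1) f where
  strictMono := h.strictMono
  mem_iff x := by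
    rw [h.mem_iff]
    constructor
    · rintro ⟨h1, h2⟩
      exact ⟨by omega, h2⟩
    · rintro ⟨h1, h2⟩
      refine ⟨lt_of_le_of_ne (by omega) ?_, h2⟩
      rintro rfl
      exact ha h2

theorem exists_eq_pos (h : IsEnumeration s a k f) (hk : k ≤ n) :
    ∃ hm : m = (positions (leadingSeq s k hk) a).card,
      ∀ i, f i = Fin.castLE hk (pos (leadingSeq s k hk) a (Fin.cast hm i)) := by
  set f' : Fin m → Fin k := fun i => ⟨f i, h.lt i⟩ with hf'
  have hmono : StrictMono f' := fun i j hij => h.strictMono hij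
  have himg : positions (leadingSeq s k hk) a = Finset.univ.image f' := by
    ext x
    rw [positions, Finset.mem_filter, Finset.mem_image]
    simp only [Finset.mem_univ, true_and]
    change s (Fin.castLE hk x) = a ↔ _
    have := h.mem_iff (Fin.castLE hk x)
    simp only [Fin.val_castLE, x.2, true_and] at this
    rw [← this]
    simp [hf', Fin.ext_iff]
  have hm : m = (positions (leadingSeq s k hk) a).card := by
    rw [himg, Finset.card_image_of_injective _ hmono.injective, Finset.card_univ, Fintype.card_fin]
  subst hm
  refine ⟨rfl, fun i => ?_⟩
  have := Finset.orderEmbOfFin_unique (s := positions (leadingSeq s k hk) a) rfl (f := f')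
    (fun x => by rw [himg]; simp) hmono
  rw [Fin.cast_eq_self, pos, ← this]
  rfl

end IsEnumeration

theorem superminor_eq {s : Fin n → Fin 2} {k m₀ m₁ : ℕ} {f : Fin m₀ → Fin n} {g : Fin m₁ → Fin n}
    (hf : IsEnumeration s 0 k f) (hg : IsEnumeration s 1 k g) (hk : k ≤ n) :
    superminor s k hk =
      rowDet (shiftedT s) f 0 * colDet (shiftedInv s (leading n k)) g (-m₀ + 1) := by
  obtain ⟨h₀, hf'⟩ := hf.exists_eq_pos hk
  obtain ⟨h₁, hg'⟩ := hg.exists_eq_pos hk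
  subst h₀ h₁
  simp only [Fin.cast_eq_self] at hf' hg'
  simp only [superminor, qsdet, ring_inverse_leadingT]
  simp only [rowDet, colDet, fusedDet, zero_sub, hf', hg', shiftedT, shiftedInv, leadingT, Matrix.map_apply, shiftHom_apply, Matrix.submatrix_apply, id]

/-- Enumerations with free lengths can be extended by `Fin.snoc`, which avoids transport along
cardinalities; the same induction gives the closed form of the offset. -/
theorem exists_enumeration (s : Fin n → Fin 2) (k : ℕ) (hk : k ≤ n) :
    ∃ (m₀ m₁ : ℕ) (f : Fin m₀ → Fin n) (g : Fin m₁ → Fin n),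
      IsEnumeration s 0 k f ∧ IsEnumeration s 1 k g ∧
        ∀ h : k < n, uOffset s k h = (m₁ : ℤ) - m₀ + (s ⟨k, h⟩ : ℕ) := by
  have hcases : ∀ x : Fin 2, x = 0 ∨ x = 1 := by decide
  induction k with
  | zero =>
    refine ⟨0, 0, Fin.elim0, Fin.elim0, ⟨fun i => i.elim0, fun x => ?_⟩,
      ⟨fun i => i.elim0, fun x => ?_⟩, fun h => ?_⟩
    · simp
    · simp
    · simp [uOffset]
  | succ k ih =>
    obtain ⟨m₀, m₁, f, g, hf, hg, hu⟩ := ih (by omega)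
    have hk' : k < n := hk
    have hu := hu hk'
    rcases hcases (s ⟨k, hk'⟩) with h | h
    · refine ⟨m₀ + 1, m₁, _, g, hf.snoc hk' h, hg.succ hk' (by simp [h]), fun h' => ?_⟩
      rw [uOffset, hu, h]
      rcases hcases (s ⟨k + 1, h'⟩) with h2 | h2
      · simp [h2]
        ring
      · simp [h2]
        ring
    · refine ⟨m₀, m₁ + 1, f, _, hf.succ hk' (by simp [h]), hg.snoc hk' h, fun h' => ?_⟩
      rw [uOffset, hu, h]
      rcases hcases (s ⟨k + 1, h'⟩) with h2 | h2
      · simp [h2]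
        ring
      · simp [h2]
        ring

theorem ring_inverse_shift_inverse {R : Type*} [Ring R] [Algebra ℂ R] (c : ℂ) {x : R⟦X⟧}
    (hx : IsUnit x) : Ring.inverse (shift c (Ring.inverse x)) = shift c x := by
  obtain ⟨u, rfl⟩ := hx
  rw [Ring.inverse_unit]
  exact Ring.inverse_unit (Units.map (shiftHom (R := R) c).toMonoidHom u⁻¹)

theorem leading_erase (k : Fin n) : (leading n (k + 1)).erase k = leading n k := by
  ext x
  simp only [leading, Finset.mem_erase, Finset.mem_filter, Finset.mem_univ, true_and, Fin.ext_iff,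
    ne_eq]
  omega

theorem superminor_succ (s : Fin n → Fin 2) (i : Fin n) :
    superminor s (i + 1) i.isLt = superminor s i i.isLt.le *
      shift ((uOffset s i i.isLt : ℤ) : ℂ) (dTilde s i) := by
  obtain ⟨m₀, m₁, f, g, hf, hg, hu⟩ := exists_enumeration s i i.isLt.le
  have hcases : ∀ x : Fin 2, x = 0 ∨ x = 1 := by decide
  have hR := isInvertibleRTT s
  obtain ⟨F, E, -, hd⟩ := d_spec s
  rw [superminor_eq hf hg, hu i.isLt]
  rcases hcases (s i) with h | h
  · have hf' := hf.snoc i.isLt h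
    have hg' := hg.succ i.isLt (by simp [h])
    rw [superminor_eq hf' hg']
    have := hR.even_step hf'.strictMono.injective hg'.strictMono.injective
      (fun a => by rw [hf'.digit]; rfl) (fun a => by rw [hg'.digit]; rfl)
      (K := leading n (i + 1)) (fun a => by simpa [leading] using hg'.lt a) ?_ 0
    · simp only [Fin.snoc_last, leading_erase, zero_sub] at this
      -- The extra zero lowers the initial argument of the odd factor from `1 - m₀` to `-m₀`;
      -- crossing the odd factor restores it.
      rw [show (-((m₀ + 1 : ℕ) : ℂ) + 1) = -m₀ by push_cast; ring, this, shiftedInv_leading]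
      congr 1
      · congr 2
        funext a
        simp
      · rw [dTilde, if_pos h, ring_inverse_shift_inverse _ (hd i)]
        congr 1
        simp only [Fin.eta, h, Fin.val_zero]
        push_cast
        ring
    -- Deleting the ones from the leading block leaves exactly the zeros, so the even minor and the
    -- start of the chain use the same block.
    · ext x
      have h1 := hf'.mem_iff x
      have h2 := hg'.mem_iff x
      simp only [truncate, leading, Finset.mem_filter, Finset.mem_univ, true_and, Finset.mem_image,
        Nat.zero_le, forall_const, h1]
      rcases hcases (s x) with h3 | h3
      · have h4 : ∀ q, x ≠ (g q) := by
          rintro q rfl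
          rw [hg'.digit] at h3
          exact one_ne_zero h3
        simp [h3, h4]
      · simp only [h3, one_ne_zero, and_false, iff_false, not_and, not_forall, not_not, and_true] at h2 ⊢
        intro h4
        obtain ⟨q, hq⟩ := h2.2 h4
        exact ⟨q, hq.symm⟩
  · have hf' := hf.succ i.isLt (by simp [h])
    have hg' := hg.snoc i.isLt h
    rw [superminor_eq hf' hg']
    have := hR.odd_step hg'.strictMono.injective (fun a => by rw [hg'.digit]; rfl)
      (K := leading n (i + 1)) (fun a => by simpa [leading] using hg'.lt a) (-m₀ + 1)
    simp only [Fin.snoc_last, leading_erase] at this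
    rw [this, shiftedInv_leading, ← mul_assoc]
    congr 1
    · congr 2
      funext a
      simp
    · rw [dTilde, if_neg (by simp [h])]
      congr 1
      simp only [Fin.eta, h, Fin.val_one]
      push_cast
      ring

theorem isUnit_superminor (s : Fin n → Fin 2) (k : ℕ) (hk : k ≤ n) :
    IsUnit (superminor s k hk) := by
  induction k with
  | zero =>
    have h : ∀ a, IsEnumeration s a 0 (Fin.elim0 : Fin 0 → Fin n) := fun a =>
      ⟨fun i => i.elim0, by simp⟩
    rw [superminor_eq (h 0) (h 1)]
    simp [rowDet, colDet, fusedDet]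
  | succ k ih =>
    rw [superminor_succ s ⟨k, hk⟩]
    refine (ih _).mul ?_
    obtain ⟨F, E, -, hd⟩ := d_spec s
    refine IsUnit.map (shiftHom _) ?_
    rw [dTilde]
    split_ifs
    · exact hd _
    · exact (hd _).ringInverse

end Concrete

end SuperYangian

end

/-- For every `0^M 1^N`-sequence `s` and every index `i` (zero-based here), `d̃_i(u_i)` is the
inverse of the preceding leading quantum superminor times the next one; in particular that
superminor is invertible. -/
theorem mainTheorem5 (M N : ℕ) (s : Fin (M + N) → Fin 2) (_hs : SuperYangian.IsZeroOneSeq M N s)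
    (i : Fin (M + N)) :
    IsUnit (SuperYangian.superminor s (i : ℕ) i.isLt.le) ∧
      SuperYangian.shift ((SuperYangian.uOffset s (i : ℕ) i.isLt : ℤ) : ℂ)
          (SuperYangian.dTilde s i) =
        Ring.inverse (SuperYangian.superminor s (i : ℕ) i.isLt.le) *
          SuperYangian.superminor s ((i : ℕ) + 1) i.isLt := by
  have hu := SuperYangian.isUnit_superminor s i i.isLt.le
  refine ⟨hu, ?_⟩
  rw [SuperYangian.superminor_succ, ← mul_assoc, Ring.inverse_mul_cancel _ hu, one_mul]
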